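/- Let $m\ge 0$ and $n\ge 1$ be integers, let $U\subset\mathbf R^n$ be open, and let $G$ be a complete normed commutative group, i.e., a commutative group with a function $|\cdot|:G\to[0,\infty)$ such that $|g|=0$ iff $g=0$, $|-g|=|g|$, $|g+h|\le|g|+|h|$, and such that the metric $|g-h|$ is complete. The group $\mathbf Z$ carries its standard norm. Let $\mathbf G_{\mathrm o}(n,m)$ be the set of simple unit $m$-vectors in $\bigwedge_m\mathbf R^n$ (so $\mathbf G_{\mathrm o}(n,0)=\{1,-1\}$), and let $\mathbf G(n,m,G)$ be the topological quotient of $\mathbf G_{\mathrm o}(n,m)\times G$ by the identification $(\zeta,g)\sim(-\zeta,-g)$; write $[\zeta,g]$ for the class of $(\zeta,g)$, $|[\zeta,g]|=|g|$, and $\pi([\zeta,g])=\{v\in\mathbf R^n: v\wedge\zeta=0\}$. In each fibre of $\pi$, put $[\zeta,g]+[\zeta,g']=[\zeta,g+g']$; also put $[\zeta,d]\cdot g=[\zeta,dg]$ for $d\in\mathbf Z$ and $g\in G$. Let $L(U,m,G)$ be the set of all partial functions $\sigma$ from $U$ to $\mathbf G(n,m,G)$ such that: $M=\{x:|\sigma(x)|>0\}$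 is $\mathscr H^m$ measurable; $\sigma$ is $\mathscr H^m\llcorner M$ measurable; some separable subset of $\mathbf G(n,m,G)$ contains $\sigma(x)$ for $\mathscr H^m$ almost all $x\in M$; $\int_{K\cap M}|\sigma|\,d\mathscr H^m<\infty$ for every compact $K\subset U$; and, for the measure $\phi=(\mathscr H^m\llcorner M)\llcorner|\sigma|$, $\phi$ almost all of $U$ is covered by countably many Lipschitz images of bounded subsets of $\mathbf R^m$, and $\operatorname{Tan}^m(\phi,x)=\pi(\sigma(x))$ for $\phi$ almost all $x$. Here $\operatorname{Tan}^m(\phi,x)$ is the intersection of the tangent cones $\operatorname{Tan}(S,x)$ over all sets $S$ such that $\lim_{r\to0+}r^{-m}\phi(\mathbf B(x,r)\setminus S)=0$. Call $\sigma,\tau\in L(U,m,G)$ equivalent if their restrictions to $\{|\sigma|>0\}$ and $\{|\tau|>0\}$ are $\mathscr H^m$ almost equal. The set $\mathscr R_m^{\mathrm{loc}}(U,G)$ of equivalence classes ($m$ dimensional locally rectifiable $G$ chains in $U$) is a commutative group under almost everywhere fibrewise addition of representatives (undefined values counting as $0$). For $S\in\mathscr R_m^{\mathrm{loc}}(U,\mathbf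 Z)$ and $g\in G$, let $S\cdot g\in\mathscr R_m^{\mathrm{loc}}(U,G)$ be the class of $x\mapsto\sigma(x)\cdot g$, where $\sigma$ represents $S$. This operation is bilinear. Then the homomorphism $$\rho_{U,m,G}:\mathscr R_m^{\mathrm{loc}}(U,\mathbf Z)\otimes_{\mathbf Z}G\to\mathscr R_m^{\mathrm{loc}}(U,G),\qquad \rho_{U,m,G}(S\otimes g)=S\cdot g,$$ is injective. -/

import Mathlib

namespace RectChain

open MeasureTheory Set Filter Topology
open scoped ENNReal NNReal

/-- `n`-dimensional Euclidean space. -/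
abbrev Euc (n : ℕ) : Type := EuclideanSpace ℝ (Fin n)

/-- The oriented Grassmannian `𝐆ₒ(n,m)`: simple `m`-vectors of unit length, with the metric
inherited from `⋀ₘ ℝⁿ`. For `m = 0`, this is `{1, -1}`, due to the scalar `c`; it is empty for
`m > n`. -/
def OrPlane (n m : ℕ) : Type :=
  {ζ : ⋀[ℝ]^m (Euc n) //
    ‖ζ‖ = 1 ∧ ∃ (c : ℝ) (v : Fin m → Euc n), ζ = c • exteriorPower.ιMulti ℝ m v}

namespace OrPlane
variable {n m : ℕ}

noncomputable instance : MetricSpace (OrPlane n m) := inferInstanceAs (MetricSpace (Subtype _))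

noncomputable instance : Neg (OrPlane n m) :=
  ⟨fun ζ => ⟨-ζ.1, by rw [norm_neg]; exact ζ.2.1, by
    obtain ⟨c, v, h⟩ := ζ.2.2
    exact ⟨-c, v, by rw [h]; exact (neg_smul c _).symm⟩⟩⟩

@[simp] lemma neg_val (ζ : OrPlane n m) : (-ζ).1 = -ζ.1 := rfl

lemma val_ne_zero (ζ : OrPlane n m) : ζ.1 ≠ 0 := by
  intro h
  have := ζ.2.1
  rw [h, norm_zero] at this
  exact zero_ne_one this

noncomputable instance : InvolutiveNeg (OrPlane n m) :=
  ⟨fun ζ => Subtype.ext (neg_neg ζ.1)⟩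

lemma neg_ne (ζ : OrPlane n m) : -ζ ≠ ζ := by
  intro h
  have h' : -ζ.1 = ζ.1 := congrArg Subtype.val h
  have h2 : (2 : ℝ) • ζ.1 = 0 := by
    rw [two_smul]
    nth_rewrite 1 [← h']
    exact neg_add_cancel _
  have h3 : ‖(2 : ℝ) • ζ.1‖ = 2 := by
    rw [norm_smul, ζ.2.1]; norm_num
  rw [h2, norm_zero] at h3
  norm_num at h3

lemma continuous_neg : Continuous (fun ζ : OrPlane n m => -ζ) :=
  Continuous.subtype_mk (continuous_subtype_val.neg) _

/-- The subspace `{v : v ∧ ζ = 0}` associated with `ζ`. -/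
noncomputable def plane (ζ : OrPlane n m) : Submodule ℝ (Euc n) :=
  LinearMap.ker ((LinearMap.mulRight ℝ (ζ.1 : ExteriorAlgebra ℝ (Euc n))) ∘ₗ
    ExteriorAlgebra.ι ℝ)

lemma mem_plane {ζ : OrPlane n m} {v : Euc n} :
    v ∈ ζ.plane ↔ ExteriorAlgebra.ι ℝ v * (ζ.1 : ExteriorAlgebra ℝ (Euc n)) = 0 := by
  simp [plane]

@[simp] lemma plane_neg (ζ : OrPlane n m) : (-ζ).plane = ζ.plane := by
  ext v
  simp [mem_plane]

lemma plane_eq_span (ζ : OrPlane n m) {c : ℝ} {v : Fin m → Euc n}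
    (h : ζ.1 = c • exteriorPower.ιMulti ℝ m v) :
    LinearIndependent ℝ v ∧ ζ.plane = Submodule.span ℝ (Set.range v) := by
  have hc : c ≠ 0 := by
    rintro rfl
    exact ζ.val_ne_zero (by rw [h, zero_smul])
  have hv : LinearIndependent ℝ v := by
    by_contra hv
    refine ζ.val_ne_zero ?_
    rw [h, AlternatingMap.map_linearDependent _ _ hv, smul_zero]
  have key : ∀ u : Euc n, u ∈ ζ.plane ↔
      exteriorPower.ιMulti ℝ (m + 1) (Matrix.vecCons u v) = 0 := by
    intro u
    rw [mem_plane, h, ← Subtype.coe_inj]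
    simp [ExteriorAlgebra.ιMulti_succ_apply, Matrix.vecTail, Function.comp_def, hc]
  refine ⟨hv, le_antisymm ?_ ?_⟩
  · intro u hu
    by_contra hn
    have hli : LinearIndependent ℝ (Matrix.vecCons u v) :=
      LinearIndependent.finCons hv hn
    have := (exteriorPower.ιMulti_family_linearIndependent_field (n := m + 1) hli)
    have h0 := this.ne_zero (Set.powersetCard.ofFinEmbEquiv (OrderIso.refl (Fin (m+1))).toOrderEmbedding)
    refine h0 ?_
    rw [← (key u).1 hu]
    simp only [exteriorPower.ιMulti_family, Equiv.symm_apply_apply]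
    rfl
  · rw [Submodule.span_le]
    rintro _ ⟨i, rfl⟩
    refine (key _).2 ?_
    exact AlternatingMap.map_eq_zero_of_eq _ _ (i := 0) (j := i.succ) (by simp) (Fin.succ_ne_zero i).symm

lemma eq_or_eq_neg_of_plane_eq {ζ η : OrPlane n m} (h : ζ.plane = η.plane) :
    η = ζ ∨ η = -ζ := by
  obtain ⟨c, v, hv⟩ := ζ.2.2
  obtain ⟨d, w, hw⟩ := η.2.2
  obtain ⟨hvi, hvs⟩ := ζ.plane_eq_span hv
  obtain ⟨hwi, hws⟩ := η.plane_eq_span hw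
  have hc : c ≠ 0 := by
    rintro rfl
    exact ζ.val_ne_zero (by rw [hv, zero_smul])
  let b := Module.Basis.span hvi
  have hmem : ∀ i, w i ∈ Submodule.span ℝ (Set.range v) := by
    intro i
    rw [← hvs, h, hws]
    exact Submodule.subset_span ⟨i, rfl⟩
  let w' : Fin m → Submodule.span ℝ (Set.range v) := fun i => ⟨w i, hmem i⟩
  obtain ⟨t, ht⟩ : ∃ t : ℝ, η.1 = t • ζ.1 := by
    have e2 : exteriorPower.ιMulti ℝ m w = b.det w' • exteriorPower.ιMulti ℝ m v := by
      have e1 : (exteriorPower.ιMulti ℝ m (M := Euc n)).compLinearMap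
          (Submodule.span ℝ (Set.range v)).subtype =
          (LinearMap.toSpanSingleton ℝ (⋀[ℝ]^m (Euc n))
            (exteriorPower.ιMulti ℝ m v)).compAlternatingMap b.det := by
        refine Module.Basis.ext_alternating b fun f hf => ?_
        obtain ⟨p, rfl⟩ : ∃ p : Equiv.Perm (Fin m), f = p :=
          ⟨Equiv.ofBijective f (Finite.injective_iff_bijective.1 hf), rfl⟩
        have e3 := AlternatingMap.map_perm ((exteriorPower.ιMulti ℝ m (M := Euc n)).compLinearMap
          (Submodule.span ℝ (Set.range v)).subtype) b p
        have e4 := AlternatingMap.map_perm ((LinearMap.toSpanSingleton ℝ (⋀[ℝ]^m (Euc n))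
            (exteriorPower.ιMulti ℝ m v)).compAlternatingMap b.det) b p
        have e5 : (fun i => ((b i : Submodule.span ℝ (Set.range v)) : Euc n)) = v := by
          funext i
          exact congrArg Subtype.val (Module.Basis.span_apply hvi i)
        refine e3.trans (Eq.trans ?_ e4.symm)
        congr 1
        simp [Module.Basis.det_self, e5]
      exact congrArg (fun f => f w') e1
    exact ⟨d * b.det w' * c⁻¹, by rw [hw, e2, hv]; simp [smul_smul, hc]⟩
  have habs : |t| = 1 := by
    have := η.2.1
    rw [ht, norm_smul, ζ.2.1, mul_one] at this
    exact this
  rcases (abs_eq zero_le_one).1 habs with rfl | rfl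
  · left; exact Subtype.ext (by simpa using ht)
  · right; exact Subtype.ext (ht.trans (neg_one_smul ℝ ζ.1))

end OrPlane
section Bundle
variable {n m : ℕ} {G H : Type*} [NormedAddCommGroup G] [NormedAddCommGroup H]

/-- The action of `{1, -1}` on `OrPlane n m × G`. -/
def bundleSetoid (n m : ℕ) (G : Type*) [NormedAddCommGroup G] : Setoid (OrPlane n m × G) where
  r a b := b = a ∨ b = (-a.1, -a.2)
  iseqv :=
    { refl := fun _ => Or.inl rfl
      symm := by
        rintro ⟨ζ, g⟩ ⟨ζ', g'⟩ (h | h)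
        · exact Or.inl h.symm
        · right
          simp only [Prod.mk.injEq] at h ⊢
          obtain ⟨rfl, rfl⟩ := h
          simp
      trans := by
        rintro ⟨ζ, g⟩ ⟨ζ', g'⟩ ⟨ζ'', g''⟩ (h | h) (h' | h')
        · exact Or.inl (h'.trans h)
        · right; rw [h', h]
        · right; rw [h', h]
        · left; rw [h', h]; simp }

/-- The bundle `𝐆(n,m,G)`, with fibre `G`, over the Grassmannian of `m`-planes in `ℝⁿ`:
the quotient of `OrPlane n m × G` by the identification `(ζ, g) ∼ (-ζ, -g)`.  It carries the
quotient topology, which is the topology of the metric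
`ρ(γ, γ') = inf {|ζ - ζ'| + |g - g'| : (ζ, g) ∈ γ, (ζ', g') ∈ γ'}`. -/
def Bundle (n m : ℕ) (G : Type*) [NormedAddCommGroup G] : Type _ :=
  Quotient (bundleSetoid n m G)

namespace Bundle

instance : TopologicalSpace (Bundle n m G) :=
  inferInstanceAs (TopologicalSpace (Quotient (bundleSetoid n m G)))

/-- The quotient map. -/
def mk (ζ : OrPlane n m) (g : G) : Bundle n m G := Quotient.mk (bundleSetoid n m G) (ζ, g)

lemma mk_neg (ζ : OrPlane n m) (g : G) : mk (-ζ) (-g) = mk ζ g :=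
  Quotient.sound (Or.inr (by simp))

lemma ind {p : Bundle n m G → Prop} (h : ∀ ζ g, p (mk ζ g)) (γ : Bundle n m G) : p γ :=
  Quotient.ind (fun a => h a.1 a.2) γ

lemma continuous_mk : Continuous (fun a : OrPlane n m × G => mk a.1 a.2) :=
  continuous_quotient_mk'

lemma isOpen_iff {s : Set (Bundle n m G)} :
    IsOpen s ↔ IsOpen {a : OrPlane n m × G | mk a.1 a.2 ∈ s} := Iff.rfl

/-- The `m`-plane over which a point of the bundle lies. -/
noncomputable def plane (γ : Bundle n m G) : Submodule ℝ (Euc n) :=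
  Quotient.lift (fun a : OrPlane n m × G => a.1.plane) (by
    rintro a b (h | h)
    · rw [h]
    · rw [h]; exact (OrPlane.plane_neg a.1).symm) γ

@[simp] lemma plane_mk (ζ : OrPlane n m) (g : G) : (mk ζ g).plane = ζ.plane := rfl

/-- The norm of a point of the bundle: `|mk ζ g| = |g|`. -/
noncomputable def nrm (γ : Bundle n m G) : ℝ :=
  Quotient.lift (fun a : OrPlane n m × G => ‖a.2‖) (by
    rintro a b (h | h)
    · rw [h]
    · rw [h]; exact (norm_neg a.2).symm) γ

@[simp] lemma nrm_mk (ζ : OrPlane n m) (g : G) : (mk ζ g).nrm = ‖g‖ := rfl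

lemma nrm_nonneg (γ : Bundle n m G) : 0 ≤ γ.nrm := by
  induction γ using ind with | h ζ g => exact norm_nonneg g

lemma continuous_nrm : Continuous (nrm : Bundle n m G → ℝ) :=
  Continuous.quotient_lift (continuous_norm.comp continuous_snd) _

open Classical in
/-- The element `g` of `G` with `γ = mk ζ g` if `γ` lies over the plane of `ζ`, and `0`
otherwise. -/
noncomputable def coord (ζ : OrPlane n m) (γ : Bundle n m G) : G :=
  Quotient.lift (fun a : OrPlane n m × G => if a.1 = ζ then a.2 else if a.1 = -ζ then -a.2 else 0)
    (by
      rintro a b (h | h)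
      · rw [h]
      · rw [h]
        by_cases h1 : a.1 = ζ
        · simp [h1, OrPlane.neg_ne]
        · by_cases h2 : a.1 = -ζ
          · simp [h2, OrPlane.neg_ne]
          · have h3 : ¬ (-a.1 = ζ) := fun h3 => h2 (by rw [← h3, neg_neg])
            simp [h1, h2, h3]) γ

@[simp] lemma coord_mk_self (ζ : OrPlane n m) (g : G) : coord ζ (mk ζ g) = g := by
  classical
  exact (if_pos rfl : (if ζ = ζ then g else if ζ = -ζ then -g else 0) = g)

@[simp] lemma coord_neg_mk (ζ : OrPlane n m) (g : G) : coord (-ζ) (mk ζ g) = -g := by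
  rw [← mk_neg, coord_mk_self]

lemma coord_mk_of_ne {ζ η : OrPlane n m} (g : G) (h1 : η ≠ ζ) (h2 : η ≠ -ζ) :
    coord ζ (mk η g) = 0 := by
  classical
  exact (if_neg h1).trans (if_neg h2)

lemma mk_coord {ζ : OrPlane n m} {γ : Bundle n m G} (h : γ.plane = ζ.plane) :
    mk ζ (coord ζ γ) = γ := by
  induction γ using ind with
  | h η g =>
    rcases OrPlane.eq_or_eq_neg_of_plane_eq h with rfl | rfl
    · rw [coord_mk_self]
    · rw [coord_neg_mk, mk_neg]

/-- Some orientation of the plane of a point of the bundle. -/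
noncomputable def orient (γ : Bundle n m G) : OrPlane n m := (Quotient.out γ).1

lemma plane_orient (γ : Bundle n m G) : γ.orient.plane = γ.plane := by
  conv_rhs => rw [← Quotient.out_eq γ]
  rfl

/-- Addition in the fibre: `mk ζ g + mk ζ g' = mk ζ (g + g')`; it is only meaningful for points
over the same plane. -/
noncomputable def add (γ γ' : Bundle n m G) : Bundle n m G :=
  mk γ.orient (coord γ.orient γ + coord γ.orient γ')

@[simp] lemma coord_mk_add (η ζ : OrPlane n m) (g g' : G) :
    coord η (mk ζ (g + g')) = coord η (mk ζ g) + coord η (mk ζ g') := by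
  by_cases h1 : ζ = η
  · subst h1; simp
  · by_cases h2 : ζ = -η
    · obtain rfl : η = -ζ := by rw [h2, neg_neg]
      simp [add_comm]
    · simp [coord_mk_of_ne _ h1 h2]

lemma coord_add {γ γ' : Bundle n m G} (h : γ.plane = γ'.plane) (η : OrPlane n m) :
    coord η (γ.add γ') = coord η γ + coord η γ' := by
  rw [add, coord_mk_add, mk_coord γ.plane_orient.symm, mk_coord (h ▸ γ.plane_orient.symm)]

lemma add_mk (ζ : OrPlane n m) (g g' : G) : (mk ζ g).add (mk ζ g') = mk ζ (g + g') := by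
  have h1 : ((mk ζ g).add (mk ζ g')).plane = ζ.plane := plane_orient (mk ζ g)
  rw [← mk_coord h1, coord_add (by rfl), coord_mk_self, coord_mk_self]

lemma plane_add (γ γ' : Bundle n m G) : (γ.add γ').plane = γ.plane := γ.plane_orient

lemma nrm_add_le {γ γ' : Bundle n m G} (h : γ.plane = γ'.plane) :
    (γ.add γ').nrm ≤ γ.nrm + γ'.nrm := by
  conv_rhs => rw [← mk_coord γ.plane_orient.symm,
    ← mk_coord (ζ := γ.orient) (γ := γ') (h ▸ γ.plane_orient.symm)]
  exact norm_add_le _ _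

lemma coord_eq_zero_iff {γ : Bundle n m G} : (∀ η, coord η γ = 0) ↔ γ.nrm = 0 := by
  induction γ using ind with
  | h ζ g =>
    rw [nrm_mk, norm_eq_zero]
    constructor
    · intro h
      simpa using h ζ
    · rintro rfl η
      by_cases h1 : ζ = η
      · subst h1; simp
      · by_cases h2 : ζ = -η
        · obtain rfl : η = -ζ := by rw [h2, neg_neg]
          simp
        · simp [coord_mk_of_ne _ h1 h2]

lemma eq_of_coord_eq {γ γ' : Bundle n m G} (h0 : γ.nrm ≠ 0)
    (h : ∀ η, coord η γ = coord η γ') : γ = γ' := by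
  induction γ using ind with
  | h ζ g =>
    induction γ' using ind with
    | h ζ' g' =>
      rw [nrm_mk, norm_ne_zero_iff] at h0
      have := h ζ
      rw [coord_mk_self] at this
      by_cases h1 : ζ' = ζ
      · subst h1; simpa using congrArg _ this
      · by_cases h2 : ζ' = -ζ
        · obtain rfl : ζ = -ζ' := by rw [h2, neg_neg]
          rw [coord_neg_mk] at this
          rw [this, mk_neg]
        · rw [coord_mk_of_ne _ h1 h2] at this
          exact absurd this h0

/-- The map of bundles induced by a homomorphism of the fibres. -/
def map (k : G →+ H) (γ : Bundle n m G) : Bundle n m H :=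
  Quotient.lift (fun a : OrPlane n m × G => mk a.1 (k a.2)) (by
    rintro a b (h | h)
    · rw [h]
    · rw [h]; simp only [map_neg, mk_neg]) γ

@[simp] lemma map_mk (k : G →+ H) (ζ : OrPlane n m) (g : G) :
    map k (mk ζ g) = mk ζ (k g) := rfl

lemma continuous_map {k : G →+ H} (hk : Continuous k) :
    Continuous (map k : Bundle n m G → Bundle n m H) :=
  Continuous.quotient_lift
    (continuous_mk.comp (continuous_fst.prodMk (hk.comp continuous_snd))) _

@[simp] lemma plane_map (k : G →+ H) (γ : Bundle n m G) : (map k γ).plane = γ.plane := by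
  induction γ using ind with | h ζ g => rfl

lemma coord_map (k : G →+ H) (γ : Bundle n m G) (η : OrPlane n m) :
    coord η (map k γ) = k (coord η γ) := by
  induction γ using ind with
  | h ζ g =>
    rw [map_mk]
    by_cases h1 : ζ = η
    · subst h1; simp
    · by_cases h2 : ζ = -η
      · obtain rfl : η = -ζ := by rw [h2, neg_neg]
        simp
      · simp [coord_mk_of_ne _ h1 h2]

end Bundle
end Bundle
section Measure

open Metric

/-- `S` is `m` rectifiable: the Lipschitzian image of a bounded subset of `ℝᵐ`. -/
def IsRectifiable {n : ℕ} (m : ℕ) (S : Set (Euc n)) : Prop :=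
  ∃ (A : Set (Euc m)) (K : ℝ≥0) (f : Euc m → Euc n),
    Bornology.IsBounded A ∧ LipschitzOnWith K f A ∧ f '' A = S

/-- `X` is countably `(φ, m)` rectifiable: `φ` almost all of `X` is contained in the union of a
countable family of `m` rectifiable sets. -/
def IsCountablyRectifiable {n : ℕ} (φ : Measure (Euc n)) (m : ℕ) (X : Set (Euc n)) : Prop :=
  ∃ F : Set (Set (Euc n)), F.Countable ∧ (∀ S ∈ F, IsRectifiable m S) ∧ φ (X \ ⋃₀ F) = 0

/-- The tangent cone `Tan(S, a)`. -/
def tanCone {n : ℕ} (S : Set (Euc n)) (a : Euc n) : Set (Euc n) :=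
  {v | ∀ ε > 0, ∃ x ∈ S, ∃ r : ℝ, 0 < r ∧ ‖x - a‖ < ε ∧ ‖r • (x - a) - v‖ < ε}

/-- The `m` dimensional density at `a` of the measure `φ` restricted to the complement of `S`
exists and equals `0`. -/
def ZeroDensityOff {n : ℕ} (φ : Measure (Euc n)) (m : ℕ) (S : Set (Euc n)) (a : Euc n) : Prop :=
  Tendsto (fun r : ℝ => φ (closedBall a r \ S) /
    (volume (ball (0 : Euc m) 1) * ENNReal.ofReal r ^ m)) (𝓝[>] 0) (𝓝 0)

/-- The cone `Tanᵐ(φ, a)` of `(φ, m)` approximate tangent vectors at `a`. -/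
def approxTan {n : ℕ} (m : ℕ) (φ : Measure (Euc n)) (a : Euc n) : Set (Euc n) :=
  ⋂ (S : Set (Euc n)) (_ : ZeroDensityOff φ m S a), tanCone S a

variable {n m : ℕ}

lemma IsCountablyRectifiable.union {φ ψ χ : Measure (Euc n)} {X : Set (Euc n)}
    (h : IsCountablyRectifiable φ m X) (h' : IsCountablyRectifiable ψ m X)
    (hχ : ∀ s, φ s = 0 → ψ s = 0 → χ s = 0) : IsCountablyRectifiable χ m X := by
  obtain ⟨F, hF, hr, h0⟩ := h
  obtain ⟨F', hF', hr', h0'⟩ := h'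
  refine ⟨F ∪ F', hF.union hF', ?_, hχ _ ?_ ?_⟩
  · rintro S (h | h)
    exacts [hr S h, hr' S h]
  · refine measure_mono_null (sdiff_subset_sdiff_right ?_) h0
    exact sUnion_subset_sUnion subset_union_left
  · refine measure_mono_null (sdiff_subset_sdiff_right ?_) h0'
    exact sUnion_subset_sUnion subset_union_right

lemma hausdorff_upper_density (ν : Measure (Euc n)) [IsFiniteMeasure ν] {A : Set (Euc n)}
    (hA : ν A = 0) {c : ℝ≥0∞} (hc : c ≠ 0) (hct : c ≠ ∞)
    (h : ∀ a ∈ A, ∃ᶠ r in 𝓝[>] (0 : ℝ), c * ENNReal.ofReal r ^ m ≤ ν (closedBall a r)) :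
    Measure.hausdorffMeasure (m : ℝ) A = 0 := by
  classical
  have key : ∀ k : ℕ, ∃ u : Set (Euc n), ∃ r : Euc n → ℝ, u.Countable ∧
      (∀ a ∈ u, 0 < r a ∧ r a < 1 / (k + 1 : ℝ)) ∧ A ⊆ ⋃ a ∈ u, closedBall a (5 * r a) ∧
      ∑' a : u, c * ENNReal.ofReal (r a) ^ m ≤ ENNReal.ofReal (1 / (k + 1 : ℝ)) := by
    intro k
    have hk : (0 : ℝ) < 1 / (k + 1 : ℝ) := by positivity
    obtain ⟨O, hAO, hO, hνO⟩ := A.exists_isOpen_lt_of_lt (μ := ν) (ENNReal.ofReal (1 / (k + 1 : ℝ)))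
      (by rw [hA]; exact ENNReal.ofReal_pos.2 hk)
    have hr : ∀ a : Euc n, ∃ r : ℝ, a ∈ A → (0 < r ∧ r < 1 / (k + 1 : ℝ)) ∧
        closedBall a r ⊆ O ∧ c * ENNReal.ofReal r ^ m ≤ ν (closedBall a r) := by
      intro a
      by_cases ha : a ∈ A
      · obtain ⟨ε, hε, hεO⟩ := Metric.isOpen_iff.1 hO a (hAO ha)
        have h1 : ∀ᶠ r in 𝓝[>] (0 : ℝ), r ∈ Ioo 0 (min ε (1 / (k + 1 : ℝ))) :=
          Ioo_mem_nhdsGT (lt_min hε hk)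
        obtain ⟨r, hr1, hr2⟩ := ((h a ha).and_eventually h1).exists
        refine ⟨r, fun _ => ⟨⟨hr2.1, hr2.2.trans_le (min_le_right _ _)⟩, ?_, hr1⟩⟩
        exact (closedBall_subset_ball (hr2.2.trans_le (min_le_left _ _))).trans hεO
      · exact ⟨0, fun h => absurd h ha⟩
    choose r hr using hr
    obtain ⟨u, huA, hdisj, hcov⟩ := Vitali.exists_disjoint_subfamily_covering_enlargement_closedBall
      A id r (1 / (k + 1 : ℝ)) (fun a ha => (hr a ha).1.2.le) 5 (by norm_num)
    have hu : u.Countable := by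
      refine hdisj.countable_of_nonempty_interior fun a ha => ?_
      exact ⟨a, ball_subset_interior_closedBall (mem_ball_self (hr a (huA ha)).1.1)⟩
    refine ⟨u, r, hu, fun a ha => (hr a (huA ha)).1, ?_, ?_⟩
    · intro a ha
      obtain ⟨b, hb, hab⟩ := hcov a ha
      exact mem_biUnion hb (hab (mem_closedBall_self (hr a ha).1.1.le))
    · have := hu.to_subtype
      calc ∑' a : u, c * ENNReal.ofReal (r a) ^ m
          ≤ ∑' a : u, ν (closedBall (a : Euc n) (r a)) :=
            ENNReal.tsum_le_tsum fun a => (hr a (huA a.2)).2.2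
        _ = ν (⋃ a ∈ u, closedBall a (r a)) :=
            (measure_biUnion hu hdisj fun a _ => measurableSet_closedBall).symm
        _ ≤ ν O := measure_mono (iUnion₂_subset fun a ha => (hr a (huA ha)).2.1)
        _ ≤ _ := hνO.le
  choose u r hu hr hcov hsum using key
  have : ∀ k, Countable (u k) := fun k => (hu k).to_subtype
  have hlim : Tendsto (fun k : ℕ => ENNReal.ofReal (1 / (k + 1 : ℝ))) atTop (𝓝 0) := by
    have := (ENNReal.continuous_ofReal.tendsto _).comp
      (tendsto_one_div_add_atTop_nhds_zero_nat (𝕜 := ℝ))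
    rwa [ENNReal.ofReal_zero] at this
  have hdiam : ∀ k (a : u k), ediam (closedBall (a : Euc n) (5 * r k a)) ≤
      10 * ENNReal.ofReal (r k a) := by
    intro k a
    have h0 := (hr k a a.2).1
    rw [← Metric.closedEBall_ofReal (by positivity)]
    refine Metric.ediam_closedEBall_le.trans (le_of_eq ?_)
    rw [ENNReal.ofReal_mul (by norm_num), ← mul_assoc]
    norm_num
  have hle := Measure.hausdorffMeasure_le_liminf_tsum (m : ℝ) A (l := atTop)
    (fun k : ℕ => 10 * ENNReal.ofReal (1 / (k + 1 : ℝ)))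
    (by simpa using ENNReal.Tendsto.const_mul (a := 10) hlim (Or.inr (by simp)))
    (fun k (a : u k) => closedBall (a : Euc n) (5 * r k a))
    (Eventually.of_forall fun k a => (hdiam k a).trans
      (by gcongr; exact (hr k a a.2).2.le))
    (Eventually.of_forall fun k => by
      rw [iUnion_coe_set]; exact hcov k)
  refine le_antisymm (hle.trans ?_) bot_le
  have hb : ∀ k, ∑' a : u k, ediam (closedBall (a : Euc n) (5 * r k a)) ^ (m : ℝ) ≤
      10 ^ m * c⁻¹ * ENNReal.ofReal (1 / (k + 1 : ℝ)) := by
    intro k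
    calc ∑' a : u k, ediam (closedBall (a : Euc n) (5 * r k a)) ^ (m : ℝ)
        ≤ ∑' a : u k, (10 ^ m * c⁻¹) * (c * ENNReal.ofReal (r k a) ^ m) := by
          refine ENNReal.tsum_le_tsum fun a => ?_
          rw [ENNReal.rpow_natCast]
          calc _ ≤ (10 * ENNReal.ofReal (r k a)) ^ m := by gcongr; exact hdiam k a
            _ = 10 ^ m * (c⁻¹ * c) * ENNReal.ofReal (r k a) ^ m := by
              rw [ENNReal.inv_mul_cancel hc hct, mul_pow, mul_one]
            _ = _ := by ring
      _ = (10 ^ m * c⁻¹) * ∑' a : u k, (c * ENNReal.ofReal (r k a) ^ m) := ENNReal.tsum_mul_left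
      _ ≤ _ := by gcongr; exact hsum k
  have hlim2 : Tendsto (fun k : ℕ => 10 ^ m * c⁻¹ * ENNReal.ofReal (1 / (k + 1 : ℝ))) atTop
      (𝓝 0) := by
    have := ENNReal.Tendsto.const_mul (a := 10 ^ m * c⁻¹) hlim
      (Or.inr (ENNReal.mul_ne_top (by simp) (by simpa using hc)))
    simpa using this
  calc _ ≤ liminf (fun k : ℕ => 10 ^ m * c⁻¹ * ENNReal.ofReal (1 / (k + 1 : ℝ))) atTop :=
        liminf_le_liminf (Eventually.of_forall hb)
    _ = 0 := hlim2.liminf_eq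
    _ = ⊥ := rfl

lemma ae_zeroDensityOff {φ : Measure (Euc n)} {U : Set (Euc n)} (hU : IsOpen U)
    (hφ : ∀ K, IsCompact K → K ⊆ U → φ K < ∞) {E : Set (Euc n)} (hE : MeasurableSet E) :
    ∀ᵐ x ∂(μHE[m] : Measure (Euc n)), x ∈ U → x ∈ E → ZeroDensityOff φ m E x := by
  have hr : ∀ x : Euc n, ∃ r : ℝ, x ∈ U → 0 < r ∧ closedBall x r ⊆ U := by
    intro x
    by_cases hx : x ∈ U
    · obtain ⟨r, hr, h⟩ := nhds_basis_closedBall.mem_iff.1 (hU.mem_nhds hx)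
      exact ⟨r, fun _ => ⟨hr, h⟩⟩
    · exact ⟨0, fun h => absurd h hx⟩
  choose R hR using hr
  obtain ⟨t, htU, htc, hcov⟩ := TopologicalSpace.countable_cover_nhdsWithin
    (s := U) (f := fun x => ball x (R x))
    (fun x hx => mem_nhdsWithin_of_mem_nhds (ball_mem_nhds x (hR x hx).1))
  let N : Euc n → ℕ → Set (Euc n) := fun y j => {a | a ∈ E ∧ ∃ᶠ r in 𝓝[>] (0 : ℝ),
    ((j + 1 : ℕ) : ℝ≥0∞)⁻¹ * ENNReal.ofReal r ^ m ≤
      (φ.restrict (closedBall y (R y) \ E)) (closedBall a r)}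
  have hN : ∀ y ∈ t, ∀ j, (μHE[m] : Measure (Euc n)) (N y j) = 0 := by
    intro y hy j
    have hfin : φ (closedBall y (R y) \ E) < ∞ :=
      (measure_mono sdiff_subset).trans_lt
        (hφ _ (isCompact_closedBall _ _) (hR y (htU hy)).2)
    have : IsFiniteMeasure (φ.restrict (closedBall y (R y) \ E)) :=
      ⟨by rw [Measure.restrict_apply_univ]; exact hfin⟩
    rw [Measure.euclideanHausdorffMeasure_def, Measure.smul_apply]
    rw [hausdorff_upper_density (φ.restrict (closedBall y (R y) \ E)) (A := N y j)
      (c := ((j + 1 : ℕ) : ℝ≥0∞)⁻¹) ?_ (by simp) (by simp) (fun a ha => ha.2), smul_zero]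
    refine measure_mono_null (t := E) (fun a ha => ha.1) ?_
    rw [Measure.restrict_apply hE]
    simp
  have hae : ∀ᵐ x ∂(μHE[m] : Measure (Euc n)), ∀ y ∈ t, ∀ j, x ∉ N y j := by
    rw [ae_ball_iff htc]
    intro y hy
    rw [ae_all_iff]
    intro j
    exact measure_eq_zero_iff_ae_notMem.1 (hN y hy j)
  filter_upwards [hae] with x hx hxU hxE
  obtain ⟨y, hy, hxy⟩ := mem_iUnion₂.1 (hcov hxU)
  have hα0 : volume (ball (0 : Euc m) 1) ≠ 0 := (measure_ball_pos volume _ one_pos).ne'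
  have hαt : volume (ball (0 : Euc m) 1) ≠ ∞ := measure_ball_lt_top.ne
  refine ENNReal.tendsto_nhds_zero.2 fun ε hε => ?_
  obtain ⟨j, hj⟩ := ENNReal.exists_inv_nat_lt (ENNReal.mul_pos hε.ne' hα0).ne'
  have h1 : ∀ᶠ r in 𝓝[>] (0 : ℝ), ¬ (((j + 1 : ℕ) : ℝ≥0∞)⁻¹ * ENNReal.ofReal r ^ m ≤
      (φ.restrict (closedBall y (R y) \ E)) (closedBall x r)) := by
    have := hx y hy j
    by_contra hcon
    exact this ⟨hxE, hcon⟩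
  obtain ⟨δ, hδ, hδy⟩ := nhds_basis_closedBall.mem_iff.1 (isOpen_ball.mem_nhds hxy)
  filter_upwards [h1, Ioo_mem_nhdsGT hδ] with r hr1 hr2
  have h2 : φ (closedBall x r \ E) ≤ (φ.restrict (closedBall y (R y) \ E)) (closedBall x r) := by
    rw [Measure.restrict_apply measurableSet_closedBall]
    refine measure_mono fun z hz => ⟨hz.1, ?_, hz.2⟩
    exact ball_subset_closedBall (hδy (closedBall_subset_closedBall hr2.2.le hz.1))
  refine ENNReal.div_le_of_le_mul ?_
  calc φ (closedBall x r \ E) ≤ ((j + 1 : ℕ) : ℝ≥0∞)⁻¹ * ENNReal.ofReal r ^ m :=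
        h2.trans (not_le.1 hr1).le
    _ ≤ (j : ℝ≥0∞)⁻¹ * ENNReal.ofReal r ^ m := by gcongr; omega
    _ ≤ (ε * volume (ball (0 : Euc m) 1)) * ENNReal.ofReal r ^ m := by gcongr
    _ = _ := by ring

lemma ZeroDensityOff.of_le {φ ψ : Measure (Euc n)} {E S : Set (Euc n)} {a : Euc n}
    (hE : MeasurableSet E) {C : ℝ≥0∞} (hC : C ≠ ∞) (hle : φ.restrict E ≤ C • ψ)
    (hφ : ZeroDensityOff φ m E a) (h : ZeroDensityOff ψ m S a) : ZeroDensityOff φ m S a := by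
  have h2 := hφ.add (ENNReal.Tendsto.const_mul (a := C) h (Or.inr hC))
  rw [mul_zero, add_zero] at h2
  refine tendsto_of_tendsto_of_tendsto_of_le_of_le tendsto_const_nhds h2 (fun _ => bot_le) ?_
  intro r
  have h3 : φ (closedBall a r \ S) ≤ φ (closedBall a r \ E) + C * ψ (closedBall a r \ S) := by
    rw [← measure_inter_add_sdiff (closedBall a r \ S) hE, add_comm]
    refine add_le_add (measure_mono (sdiff_subset_sdiff_left sdiff_subset)) ?_
    have := hle (closedBall a r \ S)
    rwa [Measure.restrict_apply' hE, Measure.smul_apply, smul_eq_mul] at this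
  show φ (closedBall a r \ S) / _ ≤ φ (closedBall a r \ E) / _ + C * (ψ (closedBall a r \ S) / _)
  rw [← mul_div_assoc, ENNReal.div_add_div_same]
  exact ENNReal.div_le_div_right h3 _

lemma ae_approxTan_eq {f g : Euc n → ℝ≥0∞} (hf : AEMeasurable f (μHE[m] : Measure (Euc n)))
    (hg : AEMeasurable g (μHE[m] : Measure (Euc n))) (hft : ∀ x, f x ≠ ∞) (hgt : ∀ x, g x ≠ ∞)
    {U : Set (Euc n)} (hU : IsOpen U)
    (hfK : ∀ K, IsCompact K → K ⊆ U → ((μHE[m] : Measure (Euc n)).withDensity f) K < ∞)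
    (hgK : ∀ K, IsCompact K → K ⊆ U → ((μHE[m] : Measure (Euc n)).withDensity g) K < ∞) :
    ∀ᵐ x ∂(μHE[m] : Measure (Euc n)), x ∈ U → f x ≠ 0 → g x ≠ 0 →
      approxTan m ((μHE[m] : Measure (Euc n)).withDensity f) x =
        approxTan m ((μHE[m] : Measure (Euc n)).withDensity g) x := by
  rw [withDensity_congr_ae hf.ae_eq_mk] at hfK ⊢
  rw [withDensity_congr_ae hg.ae_eq_mk] at hgK ⊢
  set f' := hf.mk f with hf'
  set g' := hg.mk g with hg'
  have mf : Measurable f' := hf.measurable_mk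
  have mg : Measurable g' := hg.measurable_mk
  let E : ℕ → Set (Euc n) := fun k => {x | ((k + 1 : ℕ) : ℝ≥0∞)⁻¹ ≤ f' x ∧
    f' x ≤ ((k + 1 : ℕ) : ℝ≥0∞) ∧ ((k + 1 : ℕ) : ℝ≥0∞)⁻¹ ≤ g' x ∧ g' x ≤ ((k + 1 : ℕ) : ℝ≥0∞)}
  have hE : ∀ k, MeasurableSet (E k) := fun k =>
    (measurableSet_le measurable_const mf).inter ((measurableSet_le mf measurable_const).inter
      ((measurableSet_le measurable_const mg).inter (measurableSet_le mg measurable_const)))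
  have hcomp : ∀ (p q : Euc n → ℝ≥0∞) (k : ℕ),
      (∀ x ∈ E k, p x ≤ ((k + 1 : ℕ) : ℝ≥0∞)) → (∀ x ∈ E k, ((k + 1 : ℕ) : ℝ≥0∞)⁻¹ ≤ q x) →
      ((μHE[m] : Measure (Euc n)).withDensity p).restrict (E k) ≤
        (((k + 1 : ℕ) : ℝ≥0∞) * ((k + 1 : ℕ) : ℝ≥0∞)) •
          ((μHE[m] : Measure (Euc n)).withDensity q) := by
    intro p q k hp hq
    refine Measure.le_iff.2 fun s hs => ?_
    rw [Measure.restrict_apply hs, withDensity_apply _ (hs.inter (hE k)), Measure.smul_apply,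
      withDensity_apply _ hs, smul_eq_mul, ← lintegral_const_mul' _ _ (by
        exact ENNReal.mul_ne_top (ENNReal.natCast_ne_top _) (ENNReal.natCast_ne_top _))]
    refine (setLIntegral_mono' (hs.inter (hE k)) fun x hx => ?_).trans
      (lintegral_mono_set inter_subset_left)
    calc p x ≤ ((k + 1 : ℕ) : ℝ≥0∞) := hp x hx.2
      _ = ((k + 1 : ℕ) : ℝ≥0∞) * ((k + 1 : ℕ) : ℝ≥0∞) * ((k + 1 : ℕ) : ℝ≥0∞)⁻¹ := by
        rw [mul_assoc, ENNReal.mul_inv_cancel (by simp) (by exact ENNReal.natCast_ne_top _), mul_one]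
      _ ≤ _ := by gcongr; exact hq x hx.2
  have h1 : ∀ᵐ x ∂(μHE[m] : Measure (Euc n)), ∀ k, x ∈ U → x ∈ E k →
      ZeroDensityOff ((μHE[m] : Measure (Euc n)).withDensity f') m (E k) x :=
    ae_all_iff.2 fun k => ae_zeroDensityOff hU hfK (hE k)
  have h2 : ∀ᵐ x ∂(μHE[m] : Measure (Euc n)), ∀ k, x ∈ U → x ∈ E k →
      ZeroDensityOff ((μHE[m] : Measure (Euc n)).withDensity g') m (E k) x :=
    ae_all_iff.2 fun k => ae_zeroDensityOff hU hgK (hE k)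
  filter_upwards [h1, h2, hf.ae_eq_mk, hg.ae_eq_mk] with x h1 h2 hfx hgx hxU hf0 hg0
  have hfx' : f x = f' x := hfx
  have hgx' : g x = g' x := hgx
  have hk : ∃ k, x ∈ E k := by
    obtain ⟨k1, hk1⟩ := ENNReal.exists_inv_nat_lt hf0
    obtain ⟨k2, hk2⟩ := ENNReal.exists_nat_gt (hft x)
    obtain ⟨k3, hk3⟩ := ENNReal.exists_inv_nat_lt hg0
    obtain ⟨k4, hk4⟩ := ENNReal.exists_nat_gt (hgt x)
    refine ⟨k1 + k2 + k3 + k4, ?_, ?_, ?_, ?_⟩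
    · rw [← hfx']
      exact le_trans (ENNReal.inv_le_inv.2 (by exact_mod_cast (by omega))) hk1.le
    · rw [← hfx']
      exact hk2.le.trans (by exact_mod_cast (by omega))
    · rw [← hgx']
      exact le_trans (ENNReal.inv_le_inv.2 (by exact_mod_cast (by omega))) hk3.le
    · rw [← hgx']
      exact hk4.le.trans (by exact_mod_cast (by omega))
  obtain ⟨k, hk⟩ := hk
  have hC : (((k + 1 : ℕ) : ℝ≥0∞) * ((k + 1 : ℕ) : ℝ≥0∞)) ≠ ∞ :=
    ENNReal.mul_ne_top (ENNReal.natCast_ne_top _) (ENNReal.natCast_ne_top _)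
  have key : ∀ S, ZeroDensityOff ((μHE[m] : Measure (Euc n)).withDensity f') m S x ↔
      ZeroDensityOff ((μHE[m] : Measure (Euc n)).withDensity g') m S x := fun S =>
    ⟨fun h => ZeroDensityOff.of_le (hE k) hC
        (hcomp g' f' k (fun x hx => hx.2.2.2) (fun x hx => hx.1)) (h2 k hxU hk) h,
      fun h => ZeroDensityOff.of_le (hE k) hC
        (hcomp f' g' k (fun x hx => hx.2.1) (fun x hx => hx.2.2.1)) (h1 k hxU hk) h⟩
  simp only [approxTan, key]

end Measure
section Chains

variable {n m : ℕ} {G H : Type*} [NormedAddCommGroup G] [NormedAddCommGroup H]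

namespace Bundle

open scoped RealInnerProductSpace

open Classical in
/-- A local trivialisation of the bundle, extended by zero. -/
noncomputable def chart (θ : ⋀[ℝ]^m (Euc n)) (γ : Bundle n m G) : ⋀[ℝ]^m (Euc n) × G :=
  Quotient.lift (fun a : OrPlane n m × G =>
    if 0 < ⟪θ, a.1.1⟫ ∧ a.2 ≠ 0 then (a.1.1, a.2)
    else if ⟪θ, a.1.1⟫ < 0 ∧ a.2 ≠ 0 then (-a.1.1, -a.2) else 0) (by
      rintro a b (h | h)
      · rw [h]
      · rw [h]
        simp only [OrPlane.neg_val, inner_neg_right, Left.neg_pos_iff, Left.neg_neg_iff, neg_neg,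
          ne_eq, neg_eq_zero]
        by_cases h1 : 0 < ⟪θ, a.1.1⟫
        · by_cases h2 : a.2 = 0
          · simp [h2]
          · simp [h1, h1.not_gt, h2]
        · by_cases h2 : a.2 = 0
          · simp [h2]
          · simp [h1, h2]) γ

lemma chart_mk_pos {θ : ⋀[ℝ]^m (Euc n)} {ζ : OrPlane n m} {g : G} (h : 0 < ⟪θ, ζ.1⟫)
    (hg : g ≠ 0) : chart θ (mk ζ g) = (ζ.1, g) := by
  classical
  exact if_pos ⟨h, hg⟩

lemma chart_spec {θ : ⋀[ℝ]^m (Euc n)} {γ : Bundle n m G} (h : chart θ γ ≠ 0) :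
    ∃ ζ g, γ = mk ζ g ∧ g ≠ 0 ∧ 0 < ⟪θ, ζ.1⟫ ∧ chart θ γ = (ζ.1, g) := by
  classical
  induction γ using ind with
  | h ζ g =>
    by_cases hg : g = 0
    · subst hg
      refine absurd ?_ h
      show (if _ then _ else if _ then _ else _) = _
      simp
    · rcases lt_trichotomy ⟪θ, ζ.1⟫ 0 with h1 | h1 | h1
      · have h2 : 0 < ⟪θ, (-ζ).1⟫ := by
          rw [OrPlane.neg_val, inner_neg_right]; linarith
        refine ⟨-ζ, -g, (mk_neg ζ g).symm, neg_ne_zero.2 hg, h2, ?_⟩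
        rw [← mk_neg, chart_mk_pos h2 (neg_ne_zero.2 hg)]
      · refine absurd ?_ h
        show (if _ then _ else if _ then _ else _) = _
        simp [h1]
      · exact ⟨ζ, g, rfl, hg, h1, chart_mk_pos h1 hg⟩

lemma chart_fst_ne_zero {θ : ⋀[ℝ]^m (Euc n)} {γ : Bundle n m G} :
    (chart θ γ).1 ≠ 0 ↔ chart θ γ ≠ 0 := by
  refine ⟨fun h h' => h (by rw [h']; rfl), fun h => ?_⟩
  obtain ⟨ζ, g, -, -, -, h'⟩ := chart_spec h
  rw [h']
  exact ζ.val_ne_zero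

lemma exists_chart_ne_zero {γ : Bundle n m G} (h : γ.nrm ≠ 0) :
    ∃ i, chart (stdOrthonormalBasis ℝ (⋀[ℝ]^m (Euc n)) i) γ ≠ 0 := by
  induction γ using ind with
  | h ζ g =>
    have hg : g ≠ 0 := by simpa using h
    by_contra! hcon
    refine ζ.val_ne_zero ?_
    rw [← (stdOrthonormalBasis ℝ (⋀[ℝ]^m (Euc n))).sum_repr' ζ.1]
    refine Finset.sum_eq_zero fun i _ => ?_
    suffices h0 : ⟪stdOrthonormalBasis ℝ (⋀[ℝ]^m (Euc n)) i, ζ.1⟫ = 0 by rw [h0, zero_smul]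
    have hi := hcon i
    rcases lt_trichotomy ⟪stdOrthonormalBasis ℝ (⋀[ℝ]^m (Euc n)) i, ζ.1⟫ 0 with h1 | h1 | h1
    · have h2 : 0 < ⟪stdOrthonormalBasis ℝ (⋀[ℝ]^m (Euc n)) i, (-ζ).1⟫ := by
        rw [OrPlane.neg_val, inner_neg_right]; linarith
      rw [← mk_neg, chart_mk_pos h2 (neg_ne_zero.2 hg)] at hi
      exact absurd (congrArg Prod.snd hi) (neg_ne_zero.2 hg)
    · exact h1
    · rw [chart_mk_pos h1 hg] at hi
      exact absurd (congrArg Prod.snd hi) hg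

lemma isOpen_chart (θ : ⋀[ℝ]^m (Euc n)) {O : Set (⋀[ℝ]^m (Euc n) × G)} (hO : IsOpen O) :
    IsOpen {γ : Bundle n m G | chart θ γ ≠ 0 ∧ chart θ γ ∈ O} := by
  rw [isOpen_iff]
  have c1 : Continuous fun a : OrPlane n m × G => a.1.1 :=
    continuous_subtype_val.comp continuous_fst
  have c2 : Continuous fun a : OrPlane n m × G => ⟪θ, a.1.1⟫ := continuous_const.inner c1
  have e : {a : OrPlane n m × G | mk a.1 a.2 ∈
      {γ : Bundle n m G | chart θ γ ≠ 0 ∧ chart θ γ ∈ O}} =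
      {a | 0 < ⟪θ, a.1.1⟫ ∧ a.2 ≠ 0 ∧ (a.1.1, a.2) ∈ O} ∪
      {a | ⟪θ, a.1.1⟫ < 0 ∧ a.2 ≠ 0 ∧ (-a.1.1, -a.2) ∈ O} := by
    ext ⟨ζ, g⟩
    simp only [mem_ofPred_eq, mem_union]
    constructor
    · rintro ⟨h, h'⟩
      obtain ⟨η, k, he, hk, hη, hc⟩ := chart_spec h
      rcases Quotient.exact he with h1 | h1
      · left
        simp only [Prod.mk.injEq] at h1
        obtain ⟨rfl, rfl⟩ := h1
        exact ⟨hη, hk, hc ▸ h'⟩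
      · right
        simp only [Prod.mk.injEq] at h1
        obtain ⟨rfl, rfl⟩ := h1
        rw [OrPlane.neg_val, inner_neg_right] at hη
        exact ⟨by linarith, neg_ne_zero.1 hk, hc ▸ h'⟩
    · rintro (⟨h1, h2, h3⟩ | ⟨h1, h2, h3⟩)
      · rw [chart_mk_pos h1 h2]
        exact ⟨fun h => h2 (congrArg Prod.snd h), h3⟩
      · have h4 : 0 < ⟪θ, (-ζ).1⟫ := by
          rw [OrPlane.neg_val, inner_neg_right]; linarith
        rw [← mk_neg, chart_mk_pos h4 (neg_ne_zero.2 h2)]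
        exact ⟨fun h => h2 (neg_eq_zero.1 (congrArg Prod.snd h)), h3⟩
  rw [e]
  refine IsOpen.union ?_ ?_
  · exact (isOpen_lt continuous_const c2).inter
      ((isOpen_ne_fun continuous_snd continuous_const).inter
        (hO.preimage (c1.prodMk continuous_snd)))
  · exact (isOpen_lt c2 continuous_const).inter
      ((isOpen_ne_fun continuous_snd continuous_const).inter
        (hO.preimage (c1.neg.prodMk continuous_snd.neg)))

end Bundle

/-- The set of all `x` in the domain of the partial function `σ` with `|σ(x)| > 0`. -/
def carrier (σ : Euc n → Option (Bundle n m G)) : Set (Euc n) :=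
  {x | ∃ γ ∈ σ x, 0 < γ.nrm}

/-- The function `|σ|`, extended by `0` outside the domain of the partial function `σ`. -/
noncomputable def density (σ : Euc n → Option (Bundle n m G)) (x : Euc n) : ℝ≥0∞ :=
  (σ x).elim 0 fun γ => ENNReal.ofReal γ.nrm

/-- The weight `(ℋᵐ ⌞ M) ⌞ |σ|`, where `M = carrier σ`. -/
noncomputable def weight (σ : Euc n → Option (Bundle n m G)) : Measure (Euc n) :=
  (μHE[m] : Measure (Euc n)).withDensity (density σ)

/-- The set `L(U, m, G)` of partial functions which represent locally rectifiable `G` chains: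
the domain is contained in `U`, the set `M = carrier σ` is `ℋᵐ` measurable, `σ` is `ℋᵐ ⌞ M`
measurable, `ℋᵐ` almost all of `M` is mapped by `σ` into some separable set, `|σ|` is
`ℋᵐ ⌞ M` integrable over compact subsets of `U`, and, with `φ = (ℋᵐ ⌞ M) ⌞ |σ|`, the set `U` is
countably `(φ, m)` rectifiable and `Tanᵐ(φ, x)` equals the plane of `σ(x)` for `φ` almost
all `x`. -/
structure IsChainRep (U : TopologicalSpace.Opens (Euc n))
    (σ : Euc n → Option (Bundle n m G)) : Prop where
  dom : ∀ x, (σ x).isSome → x ∈ U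
  carrier_meas : NullMeasurableSet (carrier σ) μHE[m]
  meas : ∀ O : Set (Bundle n m G), IsOpen O →
    NullMeasurableSet {x | x ∈ carrier σ ∧ ∃ γ ∈ σ x, γ ∈ O} μHE[m]
  separable : ∃ Z : Set (Bundle n m G), TopologicalSpace.IsSeparable Z ∧
    ∀ᵐ x ∂(μHE[m] : Measure (Euc n)), x ∈ carrier σ → ∃ γ ∈ σ x, γ ∈ Z
  finite : ∀ K : Set (Euc n), IsCompact K → K ⊆ U → weight σ K < ∞
  rect : IsCountablyRectifiable (weight σ) m (U : Set (Euc n))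
  tan : ∀ᵐ x ∂weight σ, ∃ γ ∈ σ x, approxTan m (weight σ) x = (γ.plane : Set (Euc n))

lemma density_ne_zero {σ : Euc n → Option (Bundle n m G)} {x : Euc n} :
    density σ x ≠ 0 ↔ x ∈ carrier σ := by
  unfold density carrier
  cases h : σ x with
  | none => simp [h]
  | some γ => simp [h]

lemma density_ne_top (σ : Euc n → Option (Bundle n m G)) (x : Euc n) : density σ x ≠ ∞ := by
  unfold density
  cases h : σ x <;> simp

lemma aestronglyMeasurable_of_rep {Y : Type*} [TopologicalSpace Y]
    [TopologicalSpace.PseudoMetrizableSpace Y] [Zero Y]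
    {σ : Euc n → Option (Bundle n m G)} (k : Bundle n m G → Y)
    (hk0 : ∀ γ, k γ ≠ 0 → 0 < γ.nrm)
    (hk : ∀ O : Set Y, IsOpen O → IsOpen {γ | k γ ≠ 0 ∧ k γ ∈ O})
    (meas : ∀ O : Set (Bundle n m G), IsOpen O →
      NullMeasurableSet {x | x ∈ carrier σ ∧ ∃ γ ∈ σ x, γ ∈ O} μHE[m])
    (sep : ∃ Z : Set (Bundle n m G), TopologicalSpace.IsSeparable Z ∧
      ∀ᵐ x ∂(μHE[m] : Measure (Euc n)), x ∈ carrier σ → ∃ γ ∈ σ x, γ ∈ Z) :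
    AEStronglyMeasurable (fun x => (σ x).elim 0 k) (μHE[m] : Measure (Euc n)) := by
  let _ : MeasurableSpace Y := borel Y
  have : BorelSpace Y := ⟨rfl⟩
  obtain ⟨Z, hZ, hZae⟩ := sep
  have hsep : ∃ t : Set Y, TopologicalSpace.IsSeparable t ∧
      ∀ᵐ x ∂(μHE[m] : Measure (Euc n)), (σ x).elim 0 k ∈ t := by
    obtain ⟨c, hc, hZc⟩ := hZ
    refine ⟨{0} ∪ closure (k '' c), (TopologicalSpace.IsSeparable.union
      (countable_singleton 0).isSeparable (hc.image k).isSeparable.closure), ?_⟩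
    filter_upwards [hZae] with x hx
    by_cases h0 : (σ x).elim 0 k = 0
    · left; exact h0
    · right
      cases hσ : σ x with
      | none => simp [hσ] at h0
      | some γ =>
        have hkγ : k γ ≠ 0 := by simpa [hσ] using h0
        obtain ⟨γ', hγ', hγZ⟩ := hx ⟨γ, hσ, hk0 γ hkγ⟩
        obtain rfl : γ = γ' := by
          rw [hσ] at hγ'; exact Option.some.inj hγ'
        refine mem_closure_iff.2 fun O hO hOγ => ?_
        obtain ⟨δ, hδ, hδc⟩ := mem_closure_iff.1 (hZc hγZ) _ (hk O hO) ⟨hkγ, hOγ⟩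
        exact ⟨k δ, hδ.2, ⟨δ, hδc, rfl⟩⟩
  have hopen : ∀ O : Set Y, IsOpen O →
      NullMeasurableSet ((fun x => (σ x).elim 0 k) ⁻¹' O) (μHE[m] : Measure (Euc n)) := by
    intro O hO
    have e : ∀ O : Set Y, {x | x ∈ carrier σ ∧ ∃ γ ∈ σ x, γ ∈ {γ | k γ ≠ 0 ∧ k γ ∈ O}} =
        {x | (σ x).elim 0 k ≠ 0 ∧ (σ x).elim 0 k ∈ O} := by
      intro O
      ext x
      cases hσ : σ x with
      | none => simp [hσ]
      | some γ =>
        simp only [carrier, hσ, mem_ofPred_eq, Option.mem_def, Option.some.injEq, exists_eq_left',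
          Option.elim_some]
        exact ⟨fun h => h.2, fun h => ⟨hk0 _ h.1, h⟩⟩
    have h1 := meas _ (hk O hO)
    have h2 := (meas _ (hk univ isOpen_univ)).compl
    rw [e] at h1 h2
    by_cases h0 : (0 : Y) ∈ O
    · have : ((fun x => (σ x).elim 0 k) ⁻¹' O) = {x | (σ x).elim 0 k ≠ 0 ∧ (σ x).elim 0 k ∈ O} ∪
          {x | (σ x).elim 0 k ≠ 0 ∧ (σ x).elim 0 k ∈ univ}ᶜ := by
        ext x
        by_cases h : (σ x).elim 0 k = 0
        · simp [h, h0]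
        · simp [h]
      rw [this]
      exact h1.union h2
    · have : ((fun x => (σ x).elim 0 k) ⁻¹' O) =
          {x | (σ x).elim 0 k ≠ 0 ∧ (σ x).elim 0 k ∈ O} := by
        ext x
        by_cases h : (σ x).elim 0 k = 0
        · simp [h, h0]
        · simp [h]
      rw [this]
      exact h1
  have hnull : NullMeasurable (fun x => (σ x).elim 0 k) (μHE[m] : Measure (Euc n)) := by
    intro s hs
    have := measurable_of_isOpen (γ := Y) (δ := NullMeasurableSpace (Euc n) μHE[m])
      (f := fun x => (σ x).elim 0 k) (fun O hO => hopen O hO)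
    exact this hs
  obtain ⟨t, ht, htae⟩ := hsep
  rw [aestronglyMeasurable_iff_aemeasurable_separable]
  refine ⟨?_, t, ht, htae⟩
  have := ht.separableSpace
  let _ := TopologicalSpace.pseudoMetrizableSpacePseudoMetric Y
  have : SecondCountableTopology t := UniformSpace.secondCountable_of_separable t
  exact hnull.aemeasurable_of_aerange htae

lemma aemeasurable_density {σ : Euc n → Option (Bundle n m G)}
    (meas : ∀ O : Set (Bundle n m G), IsOpen O →
      NullMeasurableSet {x | x ∈ carrier σ ∧ ∃ γ ∈ σ x, γ ∈ O} μHE[m])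
    (sep : ∃ Z : Set (Bundle n m G), TopologicalSpace.IsSeparable Z ∧
      ∀ᵐ x ∂(μHE[m] : Measure (Euc n)), x ∈ carrier σ → ∃ γ ∈ σ x, γ ∈ Z) :
    AEMeasurable (density σ) (μHE[m] : Measure (Euc n)) := by
  have h := (aestronglyMeasurable_of_rep (σ := σ) Bundle.nrm
    (fun γ h => lt_of_le_of_ne γ.nrm_nonneg h.symm)
    (fun O hO => (isOpen_ne_fun Bundle.continuous_nrm continuous_const).inter
      (hO.preimage Bundle.continuous_nrm)) meas sep).aemeasurable.ennreal_ofReal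
  refine h.congr (Eventually.of_forall fun x => ?_)
  unfold density
  show ENNReal.ofReal ((σ x).elim 0 Bundle.nrm) = _
  generalize σ x = a
  cases a <;> simp

namespace IsChainRep

variable {U : TopologicalSpace.Opens (Euc n)} {σ τ : Euc n → Option (Bundle n m G)}

lemma aemeasurable (h : IsChainRep U σ) :
    AEMeasurable (density σ) (μHE[m] : Measure (Euc n)) :=
  aemeasurable_density h.meas h.separable

lemma carrier_subset (h : IsChainRep U σ) {x : Euc n} (hx : x ∈ carrier σ) : x ∈ U := by
  obtain ⟨γ, hγ, -⟩ := hx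
  exact h.dom x (by rw [Option.mem_def.1 hγ]; rfl)

lemma ae_tan (h : IsChainRep U σ) : ∀ᵐ x ∂(μHE[m] : Measure (Euc n)), x ∈ carrier σ →
    ∃ γ ∈ σ x, approxTan m (weight σ) x = (γ.plane : Set (Euc n)) := by
  have := (ae_withDensity_iff' h.aemeasurable).1 h.tan
  filter_upwards [this] with x hx hxc
  exact hx (density_ne_zero.2 hxc)

lemma ae_eq_tan (h : IsChainRep U σ)
    {G' : Type*} [NormedAddCommGroup G'] {τ : Euc n → Option (Bundle n m G')}
    (hτ : AEMeasurable (density τ) (μHE[m] : Measure (Euc n)))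
    (hfin : ∀ K : Set (Euc n), IsCompact K → K ⊆ U → weight τ K < ∞) :
    ∀ᵐ x ∂(μHE[m] : Measure (Euc n)), x ∈ carrier σ → x ∈ carrier τ →
      approxTan m (weight σ) x = approxTan m (weight τ) x := by
  filter_upwards [ae_approxTan_eq h.aemeasurable hτ (density_ne_top σ) (density_ne_top τ)
    U.isOpen h.finite hfin] with x hx h1 h2
  exact hx (h.carrier_subset h1) (density_ne_zero.2 h1) (density_ne_zero.2 h2)

end IsChainRep

/-- Two partial functions are equivalent if their restrictions to `{x : |σ(x)| > 0}` and
`{x : |τ(x)| > 0}` are `ℋᵐ` almost equal. -/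
def ChainEquiv (σ τ : Euc n → Option (Bundle n m G)) : Prop :=
  ∀ᵐ x ∂(μHE[m] : Measure (Euc n)), ∀ γ : Bundle n m G, 0 < γ.nrm → (γ ∈ σ x ↔ γ ∈ τ x)

/-- The set `L(U, m, G)` with the equivalence relation. -/
def chainSetoid (U : TopologicalSpace.Opens (Euc n)) (m : ℕ) (G : Type*) [NormedAddCommGroup G] :
    Setoid {σ : Euc n → Option (Bundle n m G) // IsChainRep U σ} where
  r σ τ := ChainEquiv σ.1 τ.1
  iseqv :=
    { refl := fun _ => Eventually.of_forall fun _ _ _ => Iff.rfl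
      symm := fun h => h.mono fun _ hx γ hγ => (hx γ hγ).symm
      trans := fun h h' => by
        filter_upwards [h, h'] with x hx hx' γ hγ
        exact (hx γ hγ).trans (hx' γ hγ) }

/-- The set `𝓡ₘˡᵒᶜ(U, G)` of `m` dimensional locally rectifiable `G` chains in `U`. -/
def LocRectChain (U : TopologicalSpace.Opens (Euc n)) (m : ℕ) (G : Type*)
    [NormedAddCommGroup G] : Type _ :=
  Quotient (chainSetoid U m G)

/-- All coordinates of an element of the bundle. -/
noncomputable def ocoord (a : Option (Bundle n m G)) : OrPlane n m → G :=
  a.elim 0 fun γ η => Bundle.coord η γ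

lemma ocoord_eq_iff {a b : Option (Bundle n m G)} :
    ocoord a = ocoord b ↔ ∀ γ : Bundle n m G, 0 < γ.nrm → (γ ∈ a ↔ γ ∈ b) := by
  have key : ∀ a b : Option (Bundle n m G), ocoord a = ocoord b →
      ∀ γ : Bundle n m G, 0 < γ.nrm → γ ∈ a → γ ∈ b := by
    intro a b h γ hγ ha
    rw [Option.mem_def] at ha
    subst ha
    have h0 : ¬ ∀ η, Bundle.coord η γ = 0 := fun h0 => hγ.ne' (Bundle.coord_eq_zero_iff.1 h0)
    cases b with
    | none => exact absurd (fun η => congrFun h η) h0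
    | some δ => rw [Bundle.eq_of_coord_eq hγ.ne' fun η => congrFun h η]; rfl
  have key2 : ∀ a : Option (Bundle n m G), (∀ γ : Bundle n m G, 0 < γ.nrm → γ ∉ a) →
      ocoord a = 0 := by
    intro a h
    cases a with
    | none => rfl
    | some γ =>
      have : γ.nrm = 0 := by
        by_contra h0
        exact h γ (lt_of_le_of_ne γ.nrm_nonneg (Ne.symm h0)) rfl
      exact funext (Bundle.coord_eq_zero_iff.2 this)
  refine ⟨fun h γ hγ => ⟨key a b h γ hγ, key b a h.symm γ hγ⟩, fun h => ?_⟩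
  by_cases h0 : ∀ γ : Bundle n m G, 0 < γ.nrm → γ ∉ a
  · rw [key2 a h0, key2 b fun γ hγ hb => h0 γ hγ ((h γ hγ).2 hb)]
  · push Not at h0
    obtain ⟨γ, hγ, ha⟩ := h0
    rw [Option.mem_def.1 ha, Option.mem_def.1 ((h γ hγ).1 ha)]

/-- The class of all coordinates of a chain. -/
noncomputable def LocRectChain.germ {U : TopologicalSpace.Opens (Euc n)}
    (S : LocRectChain U m G) : Germ (ae (μHE[m] : Measure (Euc n))) (OrPlane n m → G) :=
  Quotient.lift (s := chainSetoid U m G)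
    (fun σ => ((fun x => ocoord (σ.1 x) : Euc n → OrPlane n m → G) :
      Germ (ae (μHE[m] : Measure (Euc n))) (OrPlane n m → G)))
    (fun _ _ h => Germ.coe_eq.2 (h.mono fun _ hx => ocoord_eq_iff.2 hx)) S

lemma LocRectChain.germ_injective {U : TopologicalSpace.Opens (Euc n)} :
    Function.Injective (germ : LocRectChain U m G → _) := by
  intro S T
  refine Quotient.inductionOn₂ S T fun σ τ h => Quotient.sound ?_
  exact (Germ.coe_eq.1 h).mono fun _ hx => ocoord_eq_iff.1 hx

/-! ### Operations on representatives -/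

open Classical in
/-- Pointwise addition of values of partial functions, where undefined values count as zero; the
sum of nonzero values over distinct planes is undefined. -/
noncomputable def oadd : Option (Bundle n m G) → Option (Bundle n m G) → Option (Bundle n m G)
  | none, b => b
  | some γ, none => some γ
  | some γ, some γ' =>
    if γ.nrm = 0 then some γ' else if γ'.nrm = 0 then some γ
    else if γ.plane = γ'.plane then some (γ.add γ') else none

lemma oadd_of_eq {γ γ' : Bundle n m G} (h : γ.nrm ≠ 0) (h' : γ'.nrm ≠ 0)
    (hp : γ.plane = γ'.plane) : oadd (some γ) (some γ') = some (γ.add γ') := by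
  simp [oadd, h, h', hp]

lemma oadd_of_ne {γ γ' : Bundle n m G} (h : γ.nrm ≠ 0) (h' : γ'.nrm ≠ 0)
    (hp : γ.plane ≠ γ'.plane) : oadd (some γ) (some γ') = none := by
  simp [oadd, h, h', hp]

lemma ocoord_oadd {a b : Option (Bundle n m G)}
    (h : ∀ γ ∈ a, ∀ γ' ∈ b, 0 < γ.nrm → 0 < γ'.nrm → γ.plane = γ'.plane) :
    ocoord (oadd a b) = ocoord a + ocoord b := by
  cases a with
  | none => simp [oadd, ocoord]
  | some γ =>
    cases b with
    | none => simp [oadd, ocoord]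
    | some γ' =>
      by_cases h1 : γ.nrm = 0
      · have : ocoord (some γ) = 0 := funext (Bundle.coord_eq_zero_iff.2 h1)
        simp [oadd, h1, this]
      · by_cases h2 : γ'.nrm = 0
        · have : ocoord (some γ') = 0 := funext (Bundle.coord_eq_zero_iff.2 h2)
          simp [oadd, h1, h2, this]
        · have hp := h γ rfl γ' rfl (lt_of_le_of_ne γ.nrm_nonneg (Ne.symm h1))
            (lt_of_le_of_ne γ'.nrm_nonneg (Ne.symm h2))
          rw [oadd_of_eq h1 h2 hp]
          exact funext fun η => Bundle.coord_add hp η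

lemma density_oadd_le (σ τ : Euc n → Option (Bundle n m G)) (x : Euc n) :
    density (fun x => oadd (σ x) (τ x)) x ≤ density σ x + density τ x := by
  unfold density
  show (oadd (σ x) (τ x)).elim _ _ ≤ _
  generalize σ x = a
  generalize τ x = b
  cases a with
  | none => simp [oadd]
  | some γ =>
    cases b with
    | none => simp [oadd]
    | some γ' =>
      by_cases h1 : γ.nrm = 0
      · simp [oadd, h1]
      · by_cases h2 : γ'.nrm = 0
        · simp [oadd, h1, h2]
        · by_cases hp : γ.plane = γ'.plane
          · rw [oadd_of_eq h1 h2 hp]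
            simp only [Option.elim_some]
            rw [← ENNReal.ofReal_add γ.nrm_nonneg γ'.nrm_nonneg]
            exact ENNReal.ofReal_le_ofReal (Bundle.nrm_add_le hp)
          · rw [oadd_of_ne h1 h2 hp]
            simp

lemma weight_le {σ τ ω : Euc n → Option (Bundle n m G)}
    (h : ∀ x, density ω x ≤ density σ x + density τ x)
    (hσ : AEMeasurable (density σ) (μHE[m] : Measure (Euc n))) (s : Set (Euc n)) :
    weight ω s ≤ weight σ s + weight τ s := by
  have h1 : weight ω ≤ weight σ + weight τ := by
    unfold weight
    refine Measure.le_iff.2 fun s hs => ?_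
    rw [Measure.add_apply, withDensity_apply _ hs, withDensity_apply _ hs, withDensity_apply _ hs,
      ← lintegral_add_left' hσ.restrict]
    exact lintegral_mono h
  exact h1 s

lemma sum_eq_iff {a b : Option (Bundle n m G)} {O : Set (Bundle n m G)} :
    (∃ γ ∈ a, ∃ γ' ∈ b, 0 < γ.nrm ∧ 0 < γ'.nrm ∧ γ.plane = γ'.plane ∧ γ.add γ' ∈ O) ↔
    ∃ i, (a.elim 0 (Bundle.chart (stdOrthonormalBasis ℝ (⋀[ℝ]^m (Euc n)) i))).1 ≠ 0 ∧
      (a.elim 0 (Bundle.chart (stdOrthonormalBasis ℝ (⋀[ℝ]^m (Euc n)) i))).1 =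
      (b.elim 0 (Bundle.chart (stdOrthonormalBasis ℝ (⋀[ℝ]^m (Euc n)) i))).1 ∧
      ∃ ζ : OrPlane n m,
      ζ.1 = (a.elim 0 (Bundle.chart (stdOrthonormalBasis ℝ (⋀[ℝ]^m (Euc n)) i))).1 ∧
      Bundle.mk ζ ((a.elim 0 (Bundle.chart (stdOrthonormalBasis ℝ (⋀[ℝ]^m (Euc n)) i))).2 +
      (b.elim 0 (Bundle.chart (stdOrthonormalBasis ℝ (⋀[ℝ]^m (Euc n)) i))).2) ∈ O := by
  constructor
  · rintro ⟨γ, ha, γ', hb, h1, h2, hp, hO⟩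
    rw [Option.mem_def] at ha hb
    subst ha hb
    obtain ⟨i, hi⟩ := Bundle.exists_chart_ne_zero h1.ne'
    obtain ⟨ζ, g, rfl, hg, hθ, hc⟩ := Bundle.chart_spec hi
    obtain ⟨g', rfl⟩ : ∃ g', γ' = Bundle.mk ζ g' :=
      ⟨Bundle.coord ζ γ', (Bundle.mk_coord hp.symm).symm⟩
    have hg' : g' ≠ 0 := by simpa using h2.ne'
    have hc' := Bundle.chart_mk_pos hθ hg'
    refine ⟨i, ?_, ?_, ζ, ?_, ?_⟩
    · exact Bundle.chart_fst_ne_zero.2 hi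
    · simp only [Option.elim_some, hc, hc']
    · simp only [Option.elim_some, hc]
    · simp only [Option.elim_some, hc, hc']
      rwa [Bundle.add_mk] at hO
  · rintro ⟨i, hi0, hi1, ζ, hζ, hO⟩
    cases a with
    | none => simp at hi0
    | some γ =>
      cases b with
      | none => exact absurd hi1 hi0
      | some γ' =>
        simp only [Option.elim_some] at hi0 hi1 hζ hO
        have hi0' := hi0
        rw [hi1] at hi0'
        obtain ⟨η, g, rfl, hg, hθ, hc⟩ := Bundle.chart_spec (Bundle.chart_fst_ne_zero.1 hi0)
        obtain ⟨η', g', rfl, hg', hθ', hc'⟩ := Bundle.chart_spec (Bundle.chart_fst_ne_zero.1 hi0')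
        rw [hc, hc'] at hi1
        rw [hc] at hζ
        rw [hc, hc'] at hO
        obtain rfl : η = η' := Subtype.ext hi1
        obtain rfl : ζ = η := Subtype.ext hζ
        refine ⟨_, rfl, _, rfl, by simpa using hg, by simpa using hg', rfl, ?_⟩
        rw [Bundle.add_mk]
        exact hO
lemma nullMeasurableSet_sum {σ τ : Euc n → Option (Bundle n m G)}
    {U : TopologicalSpace.Opens (Euc n)} (hσ : IsChainRep U σ) (hτ : IsChainRep U τ)
    {O : Set (Bundle n m G)} (hO : IsOpen O) :
    NullMeasurableSet {x | ∃ γ ∈ σ x, ∃ γ' ∈ τ x, 0 < γ.nrm ∧ 0 < γ'.nrm ∧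
      γ.plane = γ'.plane ∧ γ.add γ' ∈ O} μHE[m] := by
  have e : {x | ∃ γ ∈ σ x, ∃ γ' ∈ τ x, 0 < γ.nrm ∧ 0 < γ'.nrm ∧
      γ.plane = γ'.plane ∧ γ.add γ' ∈ O} = _ := Set.ext fun x => sum_eq_iff
  rw [e]
  have hmk : IsOpen {a : OrPlane n m × G | Bundle.mk a.1 a.2 ∈ O} := Bundle.isOpen_iff.1 hO
  have hemb : Topology.IsInducing (fun a : OrPlane n m × G => (a.1.1, a.2)) :=
    (Topology.IsInducing.subtypeVal).prodMap Topology.IsInducing.id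
  obtain ⟨Q, hQ, hQO⟩ := hemb.isOpen_iff.1 hmk
  let k := fun i : Fin (Module.finrank ℝ (⋀[ℝ]^m (Euc n))) =>
    (Bundle.chart (stdOrthonormalBasis ℝ (⋀[ℝ]^m (Euc n)) i) : Bundle n m G → _)
  have hk0 : ∀ i (γ : Bundle n m G), k i γ ≠ 0 → 0 < γ.nrm := by
    intro i γ h
    obtain ⟨ζ, g, rfl, hg, -⟩ := Bundle.chart_spec h
    simpa using hg
  have h1 := fun i => aestronglyMeasurable_of_rep (k i) (hk0 i)
    (fun O hO => Bundle.isOpen_chart _ hO) hσ.meas hσ.separable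
  have h2 := fun i => aestronglyMeasurable_of_rep (k i) (hk0 i)
    (fun O hO => Bundle.isOpen_chart _ hO) hτ.meas hτ.separable
  have e2 : {x | ∃ i, ((σ x).elim 0 (k i)).1 ≠ 0 ∧
      ((σ x).elim 0 (k i)).1 = ((τ x).elim 0 (k i)).1 ∧
      ∃ ζ : OrPlane n m, ζ.1 = ((σ x).elim 0 (k i)).1 ∧
      Bundle.mk ζ (((σ x).elim 0 (k i)).2 + ((τ x).elim 0 (k i)).2) ∈ O} =
      ⋃ i, ({x | ((σ x).elim 0 (k i)).1 = 0}ᶜ ∩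
        {x | ((σ x).elim 0 (k i)).1 = ((τ x).elim 0 (k i)).1} ∩
        {x | (((σ x).elim 0 (k i)).1, ((σ x).elim 0 (k i)).2 + ((τ x).elim 0 (k i)).2) ∈ Q}) := by
    ext x
    simp only [mem_ofPred_eq, mem_iUnion, mem_inter_iff, mem_compl_iff, and_assoc]
    refine exists_congr fun i => and_congr_right fun h0 => and_congr_right fun _ => ?_
    have hmem : ∀ (ζ : OrPlane n m) (g : G), Bundle.mk ζ g ∈ O ↔ (ζ.1, g) ∈ Q := fun ζ g => by
      have : (ζ, g) ∈ (fun a : OrPlane n m × G => (a.1.1, a.2)) ⁻¹' Q ↔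
        (ζ, g) ∈ {a : OrPlane n m × G | Bundle.mk a.1 a.2 ∈ O} := by rw [hQO]
      exact this.symm
    constructor
    · rintro ⟨ζ, hζ, h⟩
      rw [← hζ]
      exact (hmem _ _).1 h
    · intro h
      cases hσx : σ x with
      | none => simp [hσx] at h0
      | some γ =>
        rw [hσx] at h0 h
        obtain ⟨ζ, g, -, -, -, hc⟩ := Bundle.chart_spec (Bundle.chart_fst_ne_zero.1 h0)
        have hc' : k i γ = (ζ.1, g) := hc
        refine ⟨ζ, by simp [hc'], (hmem _ _).2 ?_⟩
        have hz : ζ.1 = (Option.elim (some γ) 0 (k i)).1 := by simp [hc']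
        rw [hz]
        exact h
  refine (show NullMeasurableSet {x | ∃ i, ((σ x).elim 0 (k i)).1 ≠ 0 ∧
      ((σ x).elim 0 (k i)).1 = ((τ x).elim 0 (k i)).1 ∧
      ∃ ζ : OrPlane n m, ζ.1 = ((σ x).elim 0 (k i)).1 ∧
      Bundle.mk ζ (((σ x).elim 0 (k i)).2 + ((τ x).elim 0 (k i)).2) ∈ O} μHE[m] from ?_)
  rw [e2]
  refine NullMeasurableSet.iUnion fun i => NullMeasurableSet.inter (.inter ?_ ?_) ?_
  · exact ((continuous_fst.comp_aestronglyMeasurable (h1 i)).nullMeasurableSet_eq_fun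
      aestronglyMeasurable_const).compl
  · exact (continuous_fst.comp_aestronglyMeasurable (h1 i)).nullMeasurableSet_eq_fun
      (continuous_fst.comp_aestronglyMeasurable (h2 i))
  · have h3 := (continuous_fst.comp_aestronglyMeasurable (h1 i)).prodMk
      ((continuous_snd.comp_aestronglyMeasurable (h1 i)).add
        (continuous_snd.comp_aestronglyMeasurable (h2 i)))
    let _ : MeasurableSpace (⋀[ℝ]^m (Euc n) × G) := borel _
    have : BorelSpace (⋀[ℝ]^m (Euc n) × G) := ⟨rfl⟩
    exact h3.aemeasurable.nullMeasurable hQ.measurableSet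

lemma separable_coeff {σ : Euc n → Option (Bundle n m G)}
    {U : TopologicalSpace.Opens (Euc n)} (hσ : IsChainRep U σ) :
    ∃ t : Set G, TopologicalSpace.IsSeparable t ∧ ∀ᵐ x ∂(μHE[m] : Measure (Euc n)),
      ∀ γ ∈ σ x, 0 < γ.nrm → ∀ ζ g, γ = Bundle.mk ζ g → g ∈ t := by
  let k := fun i : Fin (Module.finrank ℝ (⋀[ℝ]^m (Euc n))) =>
    (Bundle.chart (stdOrthonormalBasis ℝ (⋀[ℝ]^m (Euc n)) i) : Bundle n m G → _)
  have hk0 : ∀ i (γ : Bundle n m G), k i γ ≠ 0 → 0 < γ.nrm := by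
    intro i γ h
    obtain ⟨ζ, g, rfl, hg, -⟩ := Bundle.chart_spec h
    simpa using hg
  have h1 := fun i => (continuous_snd.comp_aestronglyMeasurable
    (aestronglyMeasurable_of_rep (k i) (hk0 i)
      (fun O hO => Bundle.isOpen_chart _ hO) hσ.meas hσ.separable)).isSeparable_ae_range
  choose t ht htae using h1
  refine ⟨(⋃ i, t i) ∪ (fun g => -g) '' (⋃ i, t i),
    (TopologicalSpace.IsSeparable.iUnion ht).union
      ((TopologicalSpace.IsSeparable.iUnion ht).image continuous_neg), ?_⟩
  filter_upwards [ae_all_iff.2 htae] with x hx γ hγ hγ0 ζ g hγg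
  obtain ⟨i, hi⟩ := Bundle.exists_chart_ne_zero hγ0.ne'
  have hxi := hx i
  rw [Option.mem_def.1 hγ] at hxi
  obtain ⟨η, g', hγ', -, -, hc⟩ := Bundle.chart_spec hi
  have hc' : k i γ = (η.1, g') := hc
  have hg' : g' ∈ ⋃ i, t i := mem_iUnion.2 ⟨i, by simpa [hc'] using hxi⟩
  rw [hγg] at hγ'
  rcases Quotient.exact hγ' with h | h
  · simp only [Prod.mk.injEq] at h
    left; rw [← h.2]; exact hg'
  · simp only [Prod.mk.injEq] at h
    right
    exact ⟨g', hg', by rw [h.2]; exact neg_neg g⟩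

lemma isChainRep_add {σ τ : Euc n → Option (Bundle n m G)}
    {U : TopologicalSpace.Opens (Euc n)} (hσ : IsChainRep U σ) (hτ : IsChainRep U τ) :
    IsChainRep U (fun x => oadd (σ x) (τ x)) ∧
      ∀ᵐ x ∂(μHE[m] : Measure (Euc n)), ∀ γ ∈ σ x, ∀ γ' ∈ τ x, 0 < γ.nrm → 0 < γ'.nrm →
        γ.plane = γ'.plane := by
  set ω := fun x => oadd (σ x) (τ x) with hω
  have hcar : ∀ {σ : Euc n → Option (Bundle n m G)} {x γ}, γ ∈ σ x →
      (x ∈ carrier σ ↔ 0 < γ.nrm) := by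
    intro σ x γ h
    rw [Option.mem_def] at h
    simp [carrier, h]
  have hωx : ∀ x (O : Set (Bundle n m G)), (x ∈ carrier ω ∧ ∃ γ ∈ ω x, γ ∈ O) ↔
      ((x ∈ carrier σ ∧ ∃ γ ∈ σ x, γ ∈ O) ∧ x ∉ carrier τ) ∨
      ((x ∈ carrier τ ∧ ∃ γ ∈ τ x, γ ∈ O) ∧ x ∉ carrier σ) ∨
      (∃ γ ∈ σ x, ∃ γ' ∈ τ x, 0 < γ.nrm ∧ 0 < γ'.nrm ∧
        γ.plane = γ'.plane ∧ γ.add γ' ∈ O ∩ {γ | 0 < γ.nrm}) := by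
    intro x O
    have h0 : ∀ γ : Bundle n m G, ¬ 0 < γ.nrm ↔ γ.nrm = 0 := fun γ =>
      ⟨fun h => le_antisymm (not_lt.1 h) γ.nrm_nonneg, fun h => by rw [h]; exact lt_irrefl _⟩
    have h0' : ∀ γ : Bundle n m G, 0 < γ.nrm ↔ γ.nrm ≠ 0 := fun γ => by
      rw [Ne, ← h0 γ, not_not]
    have hox : ω x = oadd (σ x) (τ x) := rfl
    simp only [carrier, mem_ofPred_eq, hox]
    generalize σ x = a
    generalize τ x = b
    cases a with
    | none => simp [oadd]
    | some γ =>
      cases b with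
      | none => simp [oadd]
      | some γ' =>
        by_cases h1 : γ.nrm = 0
        · simp [oadd, h1]
        · by_cases h2 : γ'.nrm = 0
          · simp [oadd, h1, h2, h0']
          · by_cases hp : γ.plane = γ'.plane
            · rw [oadd_of_eq h1 h2 hp]
              simp [h0', h1, h2, hp, and_comm]
            · rw [oadd_of_ne h1 h2 hp]
              simp [h0', h1, h2, hp]
  have hmeas : ∀ O : Set (Bundle n m G), IsOpen O →
      NullMeasurableSet {x | x ∈ carrier ω ∧ ∃ γ ∈ ω x, γ ∈ O} μHE[m] := by
    intro O hO
    have e : {x | x ∈ carrier ω ∧ ∃ γ ∈ ω x, γ ∈ O} =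
        ({x | x ∈ carrier σ ∧ ∃ γ ∈ σ x, γ ∈ O} ∩ (carrier τ)ᶜ) ∪
        (({x | x ∈ carrier τ ∧ ∃ γ ∈ τ x, γ ∈ O} ∩ (carrier σ)ᶜ) ∪
        {x | ∃ γ ∈ σ x, ∃ γ' ∈ τ x, 0 < γ.nrm ∧ 0 < γ'.nrm ∧
        γ.plane = γ'.plane ∧ γ.add γ' ∈ O ∩ {γ | 0 < γ.nrm}}) := Set.ext fun x => hωx x O
    rw [e]
    exact ((hσ.meas O hO).inter hτ.carrier_meas.compl).union
      (((hτ.meas O hO).inter hσ.carrier_meas.compl).union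
        (nullMeasurableSet_sum hσ hτ
          (hO.inter (isOpen_lt continuous_const Bundle.continuous_nrm))))
  have hsep : ∃ Z : Set (Bundle n m G), TopologicalSpace.IsSeparable Z ∧
      ∀ᵐ x ∂(μHE[m] : Measure (Euc n)), x ∈ carrier ω → ∃ γ ∈ ω x, γ ∈ Z := by
    obtain ⟨t, ht, htae⟩ := separable_coeff hσ
    obtain ⟨t', ht', htae'⟩ := separable_coeff hτ
    obtain ⟨Z, hZ, hZae⟩ := hσ.separable
    obtain ⟨Z', hZ', hZae'⟩ := hτ.separable
    have hs : TopologicalSpace.IsSeparable ((fun a : OrPlane n m × (G × G) =>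
        Bundle.mk a.1 (a.2.1 + a.2.2)) '' (univ ×ˢ (t ×ˢ t'))) := by
      have : TopologicalSpace.IsSeparable (univ : Set (OrPlane n m)) := by
        have : SecondCountableTopology (OrPlane n m) :=
          inferInstanceAs (SecondCountableTopology (Subtype _))
        exact TopologicalSpace.IsSeparable.of_separableSpace _
      refine (this.prod (ht.prod ht')).image ?_
      exact Bundle.continuous_mk.comp (continuous_fst.prodMk
        ((continuous_fst.comp continuous_snd).add (continuous_snd.comp continuous_snd)))
    refine ⟨_, (hZ.union hZ').union hs, ?_⟩
    filter_upwards [htae, htae', hZae, hZae'] with x h1 h2 h3 h4 hx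
    obtain ⟨γ, hγ, hγ0⟩ := hx
    refine ⟨γ, hγ, ?_⟩
    have := (hωx x {γ}).1 ⟨⟨γ, hγ, hγ0⟩, γ, hγ, rfl⟩
    rcases this with ⟨⟨hx, γ', hγ', rfl⟩, -⟩ | ⟨⟨hx, γ', hγ', rfl⟩, -⟩ |
      ⟨γ1, hγ1, γ2, hγ2, hn1, hn2, hp, h⟩
    · obtain ⟨δ, hδ, hδZ⟩ := h3 hx
      rw [Option.mem_unique hγ' hδ]
      exact Or.inl (Or.inl hδZ)
    · obtain ⟨δ, hδ, hδZ⟩ := h4 hx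
      rw [Option.mem_unique hγ' hδ]
      exact Or.inl (Or.inr hδZ)
    · right
      have e1 := Bundle.mk_coord γ1.plane_orient.symm
      have e2 : Bundle.mk γ1.orient (Bundle.coord γ1.orient γ2) = γ2 :=
        Bundle.mk_coord (hp ▸ γ1.plane_orient.symm)
      refine ⟨(γ1.orient, (Bundle.coord γ1.orient γ1, Bundle.coord γ1.orient γ2)),
        ⟨mem_univ _, h1 γ1 hγ1 hn1 _ _ e1.symm, h2 γ2 hγ2 hn2 _ _ e2.symm⟩, ?_⟩
      exact h.1
  have hle : ∀ s, weight ω s ≤ weight σ s + weight τ s :=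
    weight_le (density_oadd_le σ τ) hσ.aemeasurable
  have hfin : ∀ K : Set (Euc n), IsCompact K → K ⊆ U → weight ω K < ∞ := fun K hK hKU =>
    (hle K).trans_lt (ENNReal.add_lt_top.2 ⟨hσ.finite K hK hKU, hτ.finite K hK hKU⟩)
  have hωm := aemeasurable_density hmeas hsep
  have hplane : ∀ᵐ x ∂(μHE[m] : Measure (Euc n)), ∀ γ ∈ σ x, ∀ γ' ∈ τ x,
      0 < γ.nrm → 0 < γ'.nrm → γ.plane = γ'.plane := by
    filter_upwards [hσ.ae_tan, hτ.ae_tan, hσ.ae_eq_tan hτ.aemeasurable hτ.finite]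
      with x h1 h2 h3 γ hγ γ' hγ' hn hn'
    have hx := (hcar hγ).2 hn
    have hx' := (hcar hγ').2 hn'
    obtain ⟨δ, hδ, hδt⟩ := h1 hx
    obtain ⟨δ', hδ', hδt'⟩ := h2 hx'
    rw [Option.mem_unique hγ hδ, Option.mem_unique hγ' hδ']
    refine SetLike.coe_injective ?_
    rw [← hδt, ← hδt', h3 hx hx']
  refine ⟨⟨?_, ?_, hmeas, hsep, hfin, ?_, ?_⟩, hplane⟩
  · intro x hx
    by_contra hxU
    have h1 : σ x = none := by
      by_contra h; exact hxU (hσ.dom x (Option.isSome_iff_ne_none.2 h))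
    have h2 : τ x = none := by
      by_contra h; exact hxU (hτ.dom x (Option.isSome_iff_ne_none.2 h))
    simp [hω, h1, h2, oadd] at hx
  · have := hmeas univ isOpen_univ
    convert this using 1
    ext x
    exact ⟨fun h => ⟨h, let ⟨γ, hγ, _⟩ := h; ⟨γ, hγ, mem_univ _⟩⟩, fun h => h.1⟩
  · refine hσ.rect.union hτ.rect fun s h1 h2 => ?_
    have := hle s
    rw [h1, h2, add_zero] at this
    exact le_antisymm this bot_le
  · refine (ae_withDensity_iff' hωm).2 ?_
    filter_upwards [hσ.ae_tan, hτ.ae_tan, hσ.ae_eq_tan hωm hfin, hτ.ae_eq_tan hωm hfin]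
      with x h1 h2 h3 h4 hx
    have hxω := density_ne_zero.1 hx
    obtain ⟨γ, hγ, hγ0⟩ := id hxω
    refine ⟨γ, hγ, ?_⟩
    have := (hωx x {γ}).1 ⟨⟨γ, hγ, hγ0⟩, γ, hγ, rfl⟩
    rcases this with ⟨⟨hx, γ', hγ', rfl⟩, -⟩ | ⟨⟨hx, γ', hγ', rfl⟩, -⟩ |
      ⟨γ1, hγ1, γ2, hγ2, hn1, hn2, hp, h⟩
    · obtain ⟨δ, hδ, hδZ⟩ := h1 hx
      rw [Option.mem_unique hγ' hδ, ← hδZ, h3 hx hxω]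
    · obtain ⟨δ, hδ, hδZ⟩ := h2 hx
      rw [Option.mem_unique hγ' hδ, ← hδZ, h4 hx hxω]
    · have hx1 := (hcar hγ1).2 hn1
      obtain ⟨δ, hδ, hδZ⟩ := h1 hx1
      rw [← h3 hx1 hxω, hδZ, ← Option.mem_unique hγ1 hδ, ← h.1, Bundle.plane_add]

lemma isChainRep_zero (U : TopologicalSpace.Opens (Euc n)) :
    IsChainRep U (fun _ => (none : Option (Bundle n m G))) := by
  have hw : weight (fun _ : Euc n => (none : Option (Bundle n m G))) = 0 := by
    unfold weight
    exact withDensity_zero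
  have hc : carrier (fun _ : Euc n => (none : Option (Bundle n m G))) = ∅ := by
    ext x; simp [carrier]
  refine ⟨by simp, by rw [hc]; exact nullMeasurableSet_empty, fun O hO => by simp, ⟨∅, ?_, ?_⟩,
    by simp [hw], ⟨∅, by simp, by simp, by simp [hw]⟩, by simp [hw]⟩
  · exact countable_empty.isSeparable
  · simp [hc]

lemma isChainRep_map {σ : Euc n → Option (Bundle n m G)} {U : TopologicalSpace.Opens (Euc n)}
    (hσ : IsChainRep U σ) {k : G →+ H} (hk : Continuous k) (C : ℝ≥0) (hC : ∀ g, ‖k g‖ ≤ C * ‖g‖) :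
    IsChainRep U (fun x => (σ x).map (Bundle.map k)) := by
  set ω := fun x => (σ x).map (Bundle.map k) with hω
  have hnrm : ∀ γ : Bundle n m G, (Bundle.map k γ).nrm ≤ C * γ.nrm := by
    intro γ
    induction γ using Bundle.ind with | h ζ g => exact hC g
  have hpos : ∀ γ : Bundle n m G, 0 < (Bundle.map k γ).nrm → 0 < γ.nrm := by
    intro γ h
    by_contra h0
    have : γ.nrm = 0 := le_antisymm (not_lt.1 h0) γ.nrm_nonneg
    have := hnrm γ
    rw [‹γ.nrm = 0›, mul_zero] at this
    exact absurd h this.not_gt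
  have hmem : ∀ x (δ : Bundle n m H), δ ∈ ω x ↔ ∃ γ ∈ σ x, Bundle.map k γ = δ := by
    intro x δ
    simp [hω]
  have hcont := Bundle.continuous_map (n := n) (m := m) hk
  have hωx : ∀ x (O : Set (Bundle n m H)), (x ∈ carrier ω ∧ ∃ γ ∈ ω x, γ ∈ O) ↔
      (x ∈ carrier σ ∧ ∃ γ ∈ σ x, γ ∈ Bundle.map k ⁻¹' (O ∩ {γ | 0 < γ.nrm})) := by
    intro x O
    have hox : ω x = (σ x).map (Bundle.map k) := rfl
    simp only [carrier, mem_ofPred_eq, hox]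
    generalize σ x = a
    cases a with
    | none => simp
    | some γ =>
      simp only [Option.map_some, Option.mem_def, Option.some.injEq, exists_eq_left', mem_preimage,
        mem_inter_iff, mem_ofPred_eq]
      exact ⟨fun h => ⟨hpos γ h.1, h.2, h.1⟩, fun h => ⟨h.2.2, h.2.1⟩⟩
  have hsub : ∀ x, x ∈ carrier ω → x ∈ carrier σ := by
    rintro x ⟨δ, hδ, hδ0⟩
    exact ((hωx x univ).1 ⟨⟨δ, hδ, hδ0⟩, δ, hδ, mem_univ _⟩).1
  have hmeas : ∀ O : Set (Bundle n m H), IsOpen O →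
      NullMeasurableSet {x | x ∈ carrier ω ∧ ∃ γ ∈ ω x, γ ∈ O} μHE[m] := by
    intro O hO
    have e : {x | x ∈ carrier ω ∧ ∃ γ ∈ ω x, γ ∈ O} = {x | x ∈ carrier σ ∧
      ∃ γ ∈ σ x, γ ∈ Bundle.map k ⁻¹' (O ∩ {γ | 0 < γ.nrm})} := Set.ext fun x => hωx x O
    rw [e]
    exact hσ.meas _ ((hO.inter (isOpen_lt continuous_const Bundle.continuous_nrm)).preimage hcont)
  have hsep : ∃ Z : Set (Bundle n m H), TopologicalSpace.IsSeparable Z ∧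
      ∀ᵐ x ∂(μHE[m] : Measure (Euc n)), x ∈ carrier ω → ∃ γ ∈ ω x, γ ∈ Z := by
    obtain ⟨Z, hZ, hZae⟩ := hσ.separable
    refine ⟨Bundle.map k '' Z, hZ.image hcont, ?_⟩
    filter_upwards [hZae] with x hx hxω
    obtain ⟨γ, hγ, hγZ⟩ := hx (hsub x hxω)
    exact ⟨_, (hmem x _).2 ⟨γ, hγ, rfl⟩, γ, hγZ, rfl⟩
  have hle : ∀ s, weight ω s ≤ C * weight σ s := by
    have h1 : weight ω ≤ (C : ℝ≥0∞) • weight σ := by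
      unfold weight
      rw [← withDensity_smul' _ _ ENNReal.coe_ne_top]
      refine withDensity_mono (Eventually.of_forall fun x => ?_)
      show density ω x ≤ C * density σ x
      unfold density
      have hox : ω x = (σ x).map (Bundle.map k) := rfl
      rw [hox]
      generalize σ x = a
      cases a with
      | none => simp
      | some γ =>
        simp only [Option.map_some, Option.elim_some]
        refine (ENNReal.ofReal_le_ofReal (hnrm γ)).trans (le_of_eq ?_)
        rw [ENNReal.ofReal_mul C.coe_nonneg, ENNReal.ofReal_coe_nnreal]
    intro s
    exact h1 s
  have hfin : ∀ K : Set (Euc n), IsCompact K → K ⊆ U → weight ω K < ∞ := fun K hK hKU =>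
    (hle K).trans_lt (ENNReal.mul_lt_top ENNReal.coe_lt_top (hσ.finite K hK hKU))
  have hωm := aemeasurable_density hmeas hsep
  refine ⟨?_, ?_, hmeas, hsep, hfin, ?_, ?_⟩
  · intro x hx
    exact hσ.dom x (by simpa [hω] using hx)
  · have := hmeas univ isOpen_univ
    convert this using 1
    ext x
    exact ⟨fun h => ⟨h, let ⟨γ, hγ, _⟩ := h; ⟨γ, hγ, mem_univ _⟩⟩, fun h => h.1⟩
  · refine hσ.rect.union hσ.rect fun s h1 _ => ?_
    have := hle s
    rw [h1, mul_zero] at this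
    exact le_antisymm this bot_le
  · refine (ae_withDensity_iff' hωm).2 ?_
    filter_upwards [hσ.ae_tan, hσ.ae_eq_tan hωm hfin] with x h1 h2 hx
    have hxω := density_ne_zero.1 hx
    have hxσ := hsub x hxω
    obtain ⟨γ, hγ, hγt⟩ := h1 hxσ
    refine ⟨_, (hmem x _).2 ⟨γ, hγ, rfl⟩, ?_⟩
    rw [Bundle.plane_map, ← hγt, h2 hxσ hxω]

lemma ocoord_map (k : G →+ H) (a : Option (Bundle n m G)) :
    ocoord (a.map (Bundle.map k)) = fun η => k (ocoord a η) := by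
  cases a with
  | none => funext η; exact (map_zero k).symm
  | some γ => funext η; exact Bundle.coord_map k γ η

/-! ### The group of locally rectifiable chains -/

namespace LocRectChain

variable {U : TopologicalSpace.Opens (Euc n)}

/-- The chain represented by `σ`. -/
def mk (σ : Euc n → Option (Bundle n m G)) (h : IsChainRep U σ) : LocRectChain U m G :=
  Quotient.mk (chainSetoid U m G) ⟨σ, h⟩

lemma ind {p : LocRectChain U m G → Prop} (h : ∀ σ hσ, p (mk σ hσ)) (S : LocRectChain U m G) :
    p S :=
  Quotient.ind (fun a => h a.1 a.2) S

lemma germ_mk (σ : Euc n → Option (Bundle n m G)) (h : IsChainRep U σ) :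
    germ (mk σ h) = ((fun x => ocoord (σ x) : Euc n → OrPlane n m → G) :
      Germ (ae (μHE[m] : Measure (Euc n))) (OrPlane n m → G)) := rfl

lemma ae_ocoord_add {σ τ : Euc n → Option (Bundle n m G)} (hσ : IsChainRep U σ)
    (hτ : IsChainRep U τ) : ∀ᵐ x ∂(μHE[m] : Measure (Euc n)),
      ocoord (oadd (σ x) (τ x)) = ocoord (σ x) + ocoord (τ x) :=
  (isChainRep_add hσ hτ).2.mono fun _ hx => ocoord_oadd hx

/-- The sum of two chains: the class of `σ + τ` for representatives `σ` and `τ`. -/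
noncomputable instance : Add (LocRectChain U m G) :=
  ⟨Quotient.map₂ (sa := chainSetoid U m G) (sb := chainSetoid U m G) (sc := chainSetoid U m G)
    (fun σ τ => ⟨fun x => oadd (σ.1 x) (τ.1 x), (isChainRep_add σ.2 τ.2).1⟩) (by
      intro σ σ' h τ τ' h'
      filter_upwards [h, h', ae_ocoord_add σ.2 τ.2, ae_ocoord_add σ'.2 τ'.2] with x h1 h2 h3 h4
      refine ocoord_eq_iff.1 ?_
      rw [h3, h4, ocoord_eq_iff.2 h1, ocoord_eq_iff.2 h2])⟩

/-- The zero chain: the class of the empty function. -/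
noncomputable instance : Zero (LocRectChain U m G) := ⟨mk (fun _ => none) (isChainRep_zero U)⟩

/-- The homomorphism of groups of chains obtained by applying a homomorphism of the coefficient
groups to the values of a representative. -/
noncomputable def mapCoeff (k : G →+ H) (hk : Continuous k) (C : ℝ≥0)
    (hC : ∀ g, ‖k g‖ ≤ C * ‖g‖) : LocRectChain U m G → LocRectChain U m H :=
  Quotient.map (sa := chainSetoid U m G) (sb := chainSetoid U m H)
    (fun σ => ⟨fun x => (σ.1 x).map (Bundle.map k), isChainRep_map σ.2 hk C hC⟩) (by
      intro σ σ' h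
      refine Eventually.mono h fun x hx => ocoord_eq_iff.1 ?_
      rw [ocoord_map, ocoord_map, ocoord_eq_iff.2 hx])

/-- The negative of a chain: the class of `-σ` for a representative `σ`. -/
noncomputable instance : Neg (LocRectChain U m G) :=
  ⟨mapCoeff (negAddMonoidHom : G →+ G) continuous_neg 1 (by simp)⟩

lemma germ_add (S T : LocRectChain U m G) : germ (S + T) = germ S + germ T := by
  induction S using ind with
  | h σ hσ =>
    induction T using ind with
    | h τ hτ => exact Germ.coe_eq.2 (ae_ocoord_add hσ hτ)

lemma germ_zero : germ (0 : LocRectChain U m G) = 0 := rfl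

lemma germ_mapCoeff (k : G →+ H) (hk : Continuous k) (C : ℝ≥0) (hC : ∀ g, ‖k g‖ ≤ C * ‖g‖)
    (S : LocRectChain U m G) :
    germ (mapCoeff k hk C hC S) = (germ S).map fun c η => k (c η) := by
  induction S using ind with
  | h σ hσ => exact Germ.coe_eq.2 (Eventually.of_forall fun x => ocoord_map k (σ x))

lemma germ_neg (S : LocRectChain U m G) : germ (-S) = -germ S :=
  (germ_mapCoeff _ _ _ _ S).trans (by
    induction S using ind with
    | h σ hσ => rfl)

noncomputable instance : AddCommGroup (LocRectChain U m G) where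
  add_assoc S T R := germ_injective (by simp only [germ_add, add_assoc])
  zero_add S := germ_injective (by rw [germ_add, germ_zero, zero_add])
  add_zero S := germ_injective (by rw [germ_add, germ_zero, add_zero])
  add_comm S T := germ_injective (by rw [germ_add, germ_add, add_comm])
  neg_add_cancel S := germ_injective (by rw [germ_add, germ_neg, germ_zero, neg_add_cancel])
  nsmul := nsmulRec
  zsmul := zsmulRec

/-- The product `S · g`: the class of `σ · g` for a representative `σ` of `S`, where
`mk ζ d · g = mk ζ (d • g)` for points of the bundle. -/
noncomputable def mulCoeff (S : LocRectChain U m ℤ) (g : G) : LocRectChain U m G :=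
  mapCoeff ((zmultiplesHom G) g) continuous_of_discreteTopology ‖g‖₊ (fun d => by
    rw [zmultiplesHom_apply, mul_comm]
    exact norm_zsmul_le d g) S

lemma add_mulCoeff (S T : LocRectChain U m ℤ) (g : G) :
    (S + T).mulCoeff g = S.mulCoeff g + T.mulCoeff g := by
  refine germ_injective ?_
  simp only [mulCoeff, germ_add, germ_mapCoeff]
  induction S using ind with
  | h σ hσ =>
    induction T using ind with
    | h τ hτ =>
      refine Germ.coe_eq.2 (Eventually.of_forall fun x => ?_)
      funext η
      exact map_add _ _ _

lemma mulCoeff_add (S : LocRectChain U m ℤ) (g g' : G) :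
    S.mulCoeff (g + g') = S.mulCoeff g + S.mulCoeff g' := by
  refine germ_injective ?_
  simp only [mulCoeff, germ_add, germ_mapCoeff]
  induction S using ind with
  | h σ hσ =>
    refine Germ.coe_eq.2 (Eventually.of_forall fun x => ?_)
    funext η
    simp

open scoped TensorProduct

/-- The canonical homomorphism `ρ` with `ρ (S ⊗ g) = S · g`. -/
noncomputable def rho (U : TopologicalSpace.Opens (Euc n)) (m : ℕ) (G : Type*)
    [NormedAddCommGroup G] : LocRectChain U m ℤ ⊗[ℤ] G →+ LocRectChain U m G :=
  TensorProduct.liftAddHom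
    (AddMonoidHom.mk' (fun S => AddMonoidHom.mk' (fun g => S.mulCoeff g) (mulCoeff_add S))
      (fun S T => AddMonoidHom.ext fun g => add_mulCoeff S T g))
    (fun d S g => by
      simp only [map_zsmul]
      rfl)

lemma rho_tmul (S : LocRectChain U m ℤ) (g : G) : rho U m G (S ⊗ₜ[ℤ] g) = S.mulCoeff g := rfl

end LocRectChain

end Chains
end RectChain

/-! Write an element of the tensor product as a finite sum of `S i ⊗ g i`, and let `φ : ℤ^s → G`
send `d` to the sum of the `d i • g i`. If `rho` kills the element, then at almost every point, and
for every orientation `η`, the integer vector formed by the `η` coordinates of the `S i` lies in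
`ker φ`. So the question concerns integral chains whose values satisfy all relations imposed by one
fixed subgroup of `ℤ^s`.

Subgroups of `ℤ^s` have stacked bases (Smith normal form): there are a basis `b` of `ℤ^s` and
integers `a l` such that the vectors `a l • b l` lie in `ker φ`, while the `l`-th coordinate of
every kernel vector is divisible by `a l` (`exists_basis_dvd_repr`). Taking the `l`-th `b`
coordinate of the tuple of all `S i` yields an integral chain `S' l`, a fixed integer combination of
the `S i`, whose multiplicity is almost everywhere divisible by `a l`. Hence `S' l = a l • T l` for
some integral chain `T l` (`exists_zsmul_eq`). Rewriting the element in the new basis gives the sum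
of the `S' l ⊗ φ (b l)`, which equals the sum of the `T l ⊗ (a l • φ (b l))`, and each of these
terms is zero.

The analytic content is that division by `a l` stays within rectifiable chains. Division is not a
homomorphism on `ℤ`, but truncated division is odd, so it acts on the bundle despite the ambiguity
of orientation, and it does not increase absolute values, so the conditions on a representative
survive (`isChainRep_mapOdd`). All identities between chains are checked on germs of coordinates,
where addition is pointwise (`germ_sum_zsmul`, `germ_rho_sum`). -/

namespace RectChain

open MeasureTheory Set Filter Topology
open scoped ENNReal NNReal TensorProduct

/-! ### Stacked bases for the kernel of a homomorphism from `ℤ^ι`. -/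

/-- A homomorphism from a free group of finite rank kills multiples of the vectors of some basis,
where the multiples divide the corresponding coordinates of all elements of the kernel. -/
lemma exists_basis_dvd_repr {ι G : Type*} [Finite ι] [AddCommGroup G] (φ : (ι → ℤ) →ₗ[ℤ] G) :
    ∃ (b : Module.Basis ι ℤ (ι → ℤ)) (a : ι → ℤ), (∀ l, a l • φ (b l) = 0) ∧
      ∀ d, φ d = 0 → ∀ l, a l ∣ b.repr d l := by
  classical
  obtain ⟨r, s⟩ := Submodule.smithNormalForm (Pi.basisFun ℤ ι) (LinearMap.ker φ)
  -- The kernel may have smaller rank than `ℤ^ι`. Basis directions that carry no kernel vector get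
  -- the multiple `0`, so that divisibility there says that the coordinate vanishes.
  refine ⟨s.bM, fun l => if h : l ∈ range s.f then s.a h.choose else 0, fun l => ?_,
    fun d hd l => ?_⟩
  · by_cases h : l ∈ range s.f
    · simp only [h, dif_pos]
      have h1 : s.f h.choose = l := h.choose_spec
      have h2 : φ (s.bN h.choose) = 0 := (s.bN h.choose).2
      rwa [s.snf, h1, map_smul] at h2
    · simp [h]
  · by_cases h : l ∈ range s.f
    · simp only [h, dif_pos]
      have h1 : s.f h.choose = l := h.choose_spec
      -- A kernel vector is an integer combination of the `s.a i • s.bM (s.f i)`, so its coordinate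
      -- at `s.f i` is `s.a i` times its coordinate in the basis `s.bN` of the kernel.
      have h2 := s.repr_apply_embedding_eq_repr_smul (m := ⟨d, hd⟩) (i := h.choose)
      rw [h1] at h2
      rw [h2, map_smul]
      exact dvd_mul_right _ _
    · simp only [h, dif_neg, not_false_eq_true, zero_dvd_iff]
      exact s.repr_eq_zero_of_notMem_range ⟨d, hd⟩ h

/-! ### Changing coefficients by an odd map. -/

variable {n m : ℕ} {G H : Type*} [NormedAddCommGroup G] [NormedAddCommGroup H]

namespace Bundle

/-- The map of bundles induced by an odd map of the fibres. -/
def mapOdd (k : G → H) (hodd : ∀ g, k (-g) = -k g) (γ : Bundle n m G) : Bundle n m H :=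
  Quotient.lift (fun a : OrPlane n m × G => mk a.1 (k a.2)) (by
    rintro a b (h | h)
    · rw [h]
    · rw [h]; simp only [hodd, mk_neg]) γ

variable {k : G → H} {hodd : ∀ g, k (-g) = -k g}

@[simp] lemma mapOdd_mk (ζ : OrPlane n m) (g : G) : mapOdd k hodd (mk ζ g) = mk ζ (k g) := rfl

lemma continuous_mapOdd (hk : Continuous k) :
    Continuous (mapOdd k hodd : Bundle n m G → Bundle n m H) :=
  Continuous.quotient_lift
    (continuous_mk.comp (continuous_fst.prodMk (hk.comp continuous_snd))) _

@[simp] lemma plane_mapOdd (γ : Bundle n m G) : (mapOdd k hodd γ).plane = γ.plane := by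
  induction γ using ind with | h ζ g => rfl

/-- Coordinates with respect to orientations of other planes are `0` by convention, which is why `k
0 = 0` is needed. Oddness alone gives only `k 0 = -k 0`, which does not suffice when `H` has
2-torsion. -/
lemma coord_mapOdd (γ : Bundle n m G) (η : OrPlane n m) (hk0 : k 0 = 0) :
    coord η (mapOdd k hodd γ) = k (coord η γ) := by
  induction γ using ind with
  | h ζ g =>
    rw [mapOdd_mk]
    by_cases h1 : ζ = η
    · subst h1; simp
    · by_cases h2 : ζ = -η
      · obtain rfl : η = -ζ := by rw [h2, neg_neg]
        simp [hodd]
      · simp [coord_mk_of_ne _ h1 h2, hk0]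

end Bundle

/-- Additivity of `k` plays no role here: oddness makes `k` act on the bundle over the identity of
planes, continuity preserves measurability and separability, and the linear bound gives `weight ω ≤
C * weight σ`. Finiteness on compact sets and countable rectifiability follow from this inequality.
Tangent planes persist because the approximate tangent cones of the two weights agree at almost
every point where both densities are nonzero. -/
lemma isChainRep_mapOdd {σ : Euc n → Option (Bundle n m G)} {U : TopologicalSpace.Opens (Euc n)}
    (hσ : IsChainRep U σ) {k : G → H} (hodd : ∀ g, k (-g) = -k g) (hk : Continuous k) (C : ℝ≥0)
    (hC : ∀ g, ‖k g‖ ≤ C * ‖g‖) :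
    IsChainRep U (fun x => (σ x).map (Bundle.mapOdd k hodd)) := by
  set ω := fun x => (σ x).map (Bundle.mapOdd k hodd) with hω
  have hnrm : ∀ γ : Bundle n m G, (Bundle.mapOdd k hodd γ).nrm ≤ C * γ.nrm := by
    intro γ
    induction γ using Bundle.ind with | h ζ g => exact hC g
  have hpos : ∀ γ : Bundle n m G, 0 < (Bundle.mapOdd k hodd γ).nrm → 0 < γ.nrm := by
    intro γ h
    refine γ.nrm_nonneg.lt_of_ne' fun h0 => ?_
    have := hnrm γ
    rw [h0, mul_zero] at this
    exact this.not_gt h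
  have hmem : ∀ x (δ : Bundle n m H), δ ∈ ω x ↔ ∃ γ ∈ σ x, Bundle.mapOdd k hodd γ = δ := by
    intro x δ
    simp [hω]
  have hcont := Bundle.continuous_mapOdd (n := n) (m := m) (hodd := hodd) hk
  -- Since `k` may kill nonzero values, the new carrier can be smaller than the old one.
  -- Intersecting with the open set of positive norm expresses this as a condition on `σ` alone, to
  -- which `hσ.meas` applies.
  have hωx : ∀ x (O : Set (Bundle n m H)), (x ∈ carrier ω ∧ ∃ γ ∈ ω x, γ ∈ O) ↔
      (x ∈ carrier σ ∧ ∃ γ ∈ σ x, γ ∈ Bundle.mapOdd k hodd ⁻¹' (O ∩ {γ | 0 < γ.nrm})) := by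
    intro x O
    have hox : ω x = (σ x).map (Bundle.mapOdd k hodd) := rfl
    simp only [carrier, mem_ofPred_eq, hox]
    generalize σ x = a
    cases a with
    | none => simp
    | some γ =>
      simp only [Option.map_some, Option.mem_def, Option.some.injEq, exists_eq_left', mem_preimage,
        mem_inter_iff, mem_ofPred_eq]
      exact ⟨fun h => ⟨hpos γ h.1, h.2, h.1⟩, fun h => ⟨h.2.2, h.2.1⟩⟩
  have hsub : ∀ x, x ∈ carrier ω → x ∈ carrier σ := by
    rintro x ⟨δ, hδ, hδ0⟩
    exact ((hωx x univ).1 ⟨⟨δ, hδ, hδ0⟩, δ, hδ, mem_univ _⟩).1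
  have hmeas : ∀ O : Set (Bundle n m H), IsOpen O →
      NullMeasurableSet {x | x ∈ carrier ω ∧ ∃ γ ∈ ω x, γ ∈ O} μHE[m] := by
    intro O hO
    simp only [hωx]
    exact hσ.meas _ ((hO.inter (isOpen_lt continuous_const Bundle.continuous_nrm)).preimage hcont)
  have hsep : ∃ Z : Set (Bundle n m H), TopologicalSpace.IsSeparable Z ∧
      ∀ᵐ x ∂(μHE[m] : Measure (Euc n)), x ∈ carrier ω → ∃ γ ∈ ω x, γ ∈ Z := by
    obtain ⟨Z, hZ, hZae⟩ := hσ.separable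
    refine ⟨_, hZ.image hcont, ?_⟩
    filter_upwards [hZae] with x hx hxω
    obtain ⟨γ, hγ, hγZ⟩ := hx (hsub x hxω)
    exact ⟨_, (hmem x _).2 ⟨γ, hγ, rfl⟩, γ, hγZ, rfl⟩
  have hle : ∀ s, weight ω s ≤ C * weight σ s := by
    have h1 : weight ω ≤ (C : ℝ≥0∞) • weight σ := by
      unfold weight
      rw [← withDensity_smul' _ _ ENNReal.coe_ne_top]
      refine withDensity_mono (Eventually.of_forall fun x => ?_)
      show density ω x ≤ C * density σ x
      unfold density
      have hox : ω x = (σ x).map (Bundle.mapOdd k hodd) := rfl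
      rw [hox]
      generalize σ x = a
      cases a with
      | none => simp
      | some γ =>
        simp only [Option.map_some, Option.elim_some]
        refine (ENNReal.ofReal_le_ofReal (hnrm γ)).trans (le_of_eq ?_)
        rw [ENNReal.ofReal_mul C.coe_nonneg, ENNReal.ofReal_coe_nnreal]
    exact fun s => h1 s
  have hfin : ∀ K : Set (Euc n), IsCompact K → K ⊆ U → weight ω K < ∞ := fun K hK hKU =>
    (hle K).trans_lt (ENNReal.mul_lt_top ENNReal.coe_lt_top (hσ.finite K hK hKU))
  have hωm := aemeasurable_density hmeas hsep
  refine ⟨?_, ?_, hmeas, hsep, hfin, ?_, ?_⟩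
  · intro x hx
    exact hσ.dom x (by simpa [hω] using hx)
  · convert hmeas univ isOpen_univ using 1
    ext x
    exact ⟨fun h => ⟨h, let ⟨γ, hγ, _⟩ := h; ⟨γ, hγ, mem_univ _⟩⟩, fun h => h.1⟩
  -- The union of the covering family with itself is used only to pass from null sets of `weight σ`
  -- to null sets of `weight ω`.
  · refine hσ.rect.union hσ.rect fun s h1 _ => ?_
    have := hle s
    rw [h1, mul_zero] at this
    exact le_antisymm this bot_le
  -- Almost everywhere for `weight ω` means Hausdorff almost everywhere on the new carrier, where
  -- both densities are nonzero and the two tangent cones can be compared.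
  · refine (ae_withDensity_iff' hωm).2 ?_
    filter_upwards [hσ.ae_tan, hσ.ae_eq_tan hωm hfin] with x h1 h2 hx
    have hxω := density_ne_zero.1 hx
    have hxσ := hsub x hxω
    obtain ⟨γ, hγ, hγt⟩ := h1 hxσ
    refine ⟨_, (hmem x _).2 ⟨γ, hγ, rfl⟩, ?_⟩
    rw [Bundle.plane_mapOdd, ← hγt, h2 hxσ hxω]

lemma ocoord_mapOdd {k : G → H} {hodd : ∀ g, k (-g) = -k g} (hk0 : k 0 = 0)
    (a : Option (Bundle n m G)) :
    ocoord (a.map (Bundle.mapOdd k hodd)) = fun η => k (ocoord a η) := by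
  cases a with
  | none => funext η; exact hk0.symm
  | some γ => funext η; exact Bundle.coord_mapOdd γ η hk0

/-! ### Coordinates of chains and division of integral chains. -/

namespace LocRectChain

variable {U : TopologicalSpace.Opens (Euc n)}

/-- The homomorphism which maps a chain to the class of all its coordinates. -/
noncomputable def germHom (U : TopologicalSpace.Opens (Euc n)) (m : ℕ) (G : Type*)
    [NormedAddCommGroup G] :
    LocRectChain U m G →+ Germ (ae (μHE[m] : Measure (Euc n))) (OrPlane n m → G) where
  toFun := germ
  map_zero' := germ_zero
  map_add' := germ_add

/-- Fibrewise sums of representatives are meaningful only almost everywhere, whereas coordinates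
take values in a fixed group. As both `germ` and the passage from functions to germs are
homomorphisms, a combination of chains becomes a pointwise combination of coordinates. -/
lemma germ_sum_zsmul {ι : Type*} (s : Finset ι) (c : ι → ℤ)
    (σ : ι → Euc n → Option (Bundle n m G)) (hσ : ∀ i, IsChainRep U (σ i)) :
    germ (∑ i ∈ s, c i • mk (σ i) (hσ i)) =
      ((fun x => ∑ i ∈ s, c i • ocoord (σ i x) : Euc n → OrPlane n m → G) :
        Germ (ae (μHE[m] : Measure (Euc n))) (OrPlane n m → G)) := by
  have h1 := map_sum (germHom U m G) (fun i => c i • mk (σ i) (hσ i)) s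
  have h2 := map_sum (Germ.coeAddHom (M := OrPlane n m → G) (ae (μHE[m] : Measure (Euc n))))
    (fun i => c i • fun x => ocoord (σ i x)) s
  simp only [map_zsmul] at h1 h2
  refine (h1.trans h2.symm).trans (congrArg Germ.ofFun ?_)
  funext x
  simp

/-- An integral chain whose coordinates are almost everywhere divisible by `a` is a multiple
of `a`. -/
lemma exists_zsmul_eq {σ : Euc n → Option (Bundle n m ℤ)} (hσ : IsChainRep U σ) (a : ℤ)
    (h : ∀ᵐ x ∂(μHE[m] : Measure (Euc n)), ∀ η, a ∣ ocoord (σ x) η) :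
    ∃ T : LocRectChain U m ℤ, a • T = mk σ hσ := by
  -- Division truncated towards zero is chosen because it is odd, unlike division rounded down, and
  -- satisfies `|d.tdiv a| ≤ |d|`, so that the constant `1` works. It is also total, so the values
  -- on the exceptional null set need no separate treatment.
  have hodd : ∀ d : ℤ, (-d).tdiv a = -d.tdiv a := fun d => Int.neg_tdiv d a
  have hτ := isChainRep_mapOdd hσ (k := fun d => d.tdiv a) hodd continuous_of_discreteTopology 1 fun d => by
    rw [NNReal.coe_one, one_mul, Int.norm_eq_abs, Int.norm_eq_abs, ← Int.cast_abs,
      ← Int.cast_abs, ← Nat.cast_natAbs, ← Nat.cast_natAbs, Nat.cast_le]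
    exact Int.natAbs_tdiv_le_natAbs d a
  refine ⟨mk _ hτ, germ_injective ?_⟩
  -- The sum over a one-point index set serves to compute the coordinates of the multiple `a • T`.
  have := germ_sum_zsmul Finset.univ (fun _ : Unit => a) (fun _ => _) fun _ => hτ
  simp only [Finset.univ_unique, Finset.sum_singleton] at this
  rw [this, germ_mk]
  refine Germ.coe_eq.2 (h.mono fun x hx => funext fun η => ?_)
  simp only [ocoord_mapOdd (k := fun d : ℤ => d.tdiv a) (Int.zero_tdiv a)]
  rw [Pi.smul_apply, smul_eq_mul]
  -- The case `a = 0` is included: divisibility by `0` forces the coordinate to vanish.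
  exact Int.mul_tdiv_cancel' (hx η)

/-- For a single tensor this is how `mulCoeff` acts on coordinates; sums follow since `germ`, `rho`
and the passage to germs are additive. It turns the vanishing of `rho` into a pointwise relation
between integers and the elements `g i`. -/
lemma germ_rho_sum {ι : Type*} (s : Finset ι) (g : ι → G)
    (σ : ι → Euc n → Option (Bundle n m ℤ)) (hσ : ∀ i, IsChainRep U (σ i)) :
    germ (rho U m G (∑ i ∈ s, mk (σ i) (hσ i) ⊗ₜ[ℤ] g i)) =
      ((fun x η => ∑ i ∈ s, ocoord (σ i x) η • g i : Euc n → OrPlane n m → G) :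
        Germ (ae (μHE[m] : Measure (Euc n))) (OrPlane n m → G)) := by
  have h1 := map_sum ((germHom U m G).comp (rho U m G)) (fun i => mk (σ i) (hσ i) ⊗ₜ[ℤ] g i) s
  have h2 := map_sum (Germ.coeAddHom (M := OrPlane n m → G) (ae (μHE[m] : Measure (Euc n))))
    (fun i x η => ocoord (σ i x) η • g i) s
  have h3 : ∀ i, (germHom U m G).comp (rho U m G) (mk (σ i) (hσ i) ⊗ₜ[ℤ] g i) =
      Germ.coeAddHom (ae (μHE[m] : Measure (Euc n))) fun x η => ocoord (σ i x) η • g i := by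
    intro i
    show germ ((mk (σ i) (hσ i)).mulCoeff (g i)) = _
    rw [mulCoeff, germ_mapCoeff]
    rfl
  simp only [h3] at h1
  refine (h1.trans h2.symm).trans (congrArg Germ.ofFun ?_)
  funext x η
  simp

/-! ### Injectivity of `rho`. -/

lemma rho_injective : Function.Injective (rho U m G) := by
  classical
  refine (injective_iff_map_eq_zero _).2 fun t ht => ?_
  obtain ⟨s, rfl⟩ := TensorProduct.exists_finset t
  -- The tensors themselves become the index set, so that the multiplicity vectors live in the free
  -- group `s → ℤ` of finite rank.
  rw [← Finset.sum_coe_sort] at ht ⊢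
  have hrep : ∀ i : s, ∃ σ, ∃ hσ : IsChainRep U σ, i.1.1 = mk σ hσ := fun i => by
    induction i.1.1 using ind with
    | h σ hσ => exact ⟨σ, hσ, rfl⟩
  choose σ hσ hS using hrep
  simp only [hS] at ht ⊢
  set φ : (s → ℤ) →ₗ[ℤ] G := Fintype.linearCombination ℤ fun i : s => i.1.2 with hφ
  -- A single null set serves all the orientations `η`, since the germ takes values in functions on
  -- `OrPlane n m`.
  have hker : ∀ᵐ x ∂(μHE[m] : Measure (Euc n)), ∀ η, φ (fun i => ocoord (σ i x) η) = 0 := by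
    have h := germ_rho_sum Finset.univ (fun i : s => i.1.2) σ hσ
    rw [ht, germ_zero] at h
    exact (Germ.coe_eq.1 h.symm).mono fun x hx η => congrFun hx η
  obtain ⟨b, a, hb, ha⟩ := exists_basis_dvd_repr φ
  -- The coefficient `b.repr (Pi.single i 1) l` is an entry of the matrix changing the standard
  -- basis to `b`; the right-hand side is thus the `l`-th `b` coordinate of the tuple of chains.
  have hT : ∀ l, ∃ T : LocRectChain U m ℤ,
      a l • T = ∑ i, b.repr (Pi.single i 1) l • mk (σ i) (hσ i) := by
    intro l
    obtain ⟨τ, hτ, e⟩ : ∃ τ, ∃ hτ : IsChainRep U τ,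
        ∑ i, b.repr (Pi.single i 1) l • mk (σ i) (hσ i) = mk τ hτ := by
      induction ∑ i, b.repr (Pi.single i 1) l • mk (σ i) (hσ i) using ind with
      | h τ hτ => exact ⟨τ, hτ, rfl⟩
    rw [e]
    refine exists_zsmul_eq hτ (a l) ?_
    have h := germ_sum_zsmul Finset.univ (fun i => b.repr (Pi.single i 1) l) σ hσ
    rw [e, germ_mk] at h
    filter_upwards [Germ.coe_eq.1 h, hker] with x hx hxk η
    -- Linearity of `b.repr`, applied to the expansion of the multiplicity vector at `x` in the
    -- standard basis. That vector lies in `ker φ`, whence the divisibility by `a l`.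
    have h1 : ocoord (τ x) η = b.repr (fun i => ocoord (σ i x) η) l := by
      rw [hx, ← Finset.univ_sum_single fun i => ocoord (σ i x) η]
      simp only [Finset.sum_apply, Pi.smul_apply, map_sum, Finsupp.coe_finsetSum]
      refine Finset.sum_congr rfl fun i _ => ?_
      rw [← mul_one (ocoord (σ i x) η), ← smul_eq_mul (ocoord (σ i x) η), Pi.single_smul,
        map_smul, Finsupp.smul_apply]
      simp [mul_comm]
    rw [h1]
    exact ha _ (hxk η) l
  choose T hT using hT
  -- The element `g i` is the image under `φ` of the `i`-th standard vector, which is expanded in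
  -- `b`.
  have hg : ∀ i : s, i.1.2 = ∑ l, b.repr (Pi.single i 1) l • φ (b l) := fun i => by
    have h := congrArg φ (b.sum_repr (Pi.single i 1))
    rw [hφ, Fintype.linearCombination_apply_single, one_smul, ← hφ] at h
    rw [← h]
    simp only [map_sum, map_smul]
  -- The matrix entries move across the tensor sign onto the chains, and collecting terms by `l`
  -- produces `a l • T l`. The factor `a l` then moves back to the right, where it annihilates `φ (b
  -- l)`.
  calc ∑ i : s, mk (σ i) (hσ i) ⊗ₜ[ℤ] i.1.2
      = ∑ i : s, ∑ l, (b.repr (Pi.single i 1) l • mk (σ i) (hσ i)) ⊗ₜ[ℤ] φ (b l) := by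
        refine Finset.sum_congr rfl fun i _ => ?_
        conv_lhs => rw [hg i]
        simp only [TensorProduct.tmul_sum, TensorProduct.tmul_smul, TensorProduct.smul_tmul']
    _ = ∑ l, (a l • T l) ⊗ₜ[ℤ] φ (b l) := by
        rw [Finset.sum_comm]
        simp only [hT, TensorProduct.sum_tmul]
    _ = 0 := Finset.sum_eq_zero fun l _ => by
        rw [TensorProduct.smul_tmul, hb, TensorProduct.tmul_zero]

end LocRectChain

end RectChain
theorem mainTheorem2 (m n : ℕ) (hn : 0 < n)
    (U : TopologicalSpace.Opens (EuclideanSpace ℝ (Fin n)))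
    (G : Type*) [NormedAddCommGroup G] [CompleteSpace G] :
    Function.Injective (RectChain.LocRectChain.rho U m G) :=
  RectChain.LocRectChain.rho_injective
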